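/- **Setting.** $\mathbf{FS}$ is the category of Frölicher spaces and smooth mappings; for Frölicher spaces $X,Y$, $X^Y$ denotes the exponential in $\mathbf{FS}$. A Weil algebra is a quotient $W=C^\infty(\mathbb R^k)/I$ by an ideal $I$ contained in the maximal ideal $\mathfrak m$ of functions vanishing at $0$ and containing a power of $\mathfrak m$; $\otimes_\infty$ denotes the coproduct of $C^\infty$-algebras. The Weil prolongation $X\otimes W$ is the quotient Frölicher space of $X^{\mathbb R^k}$ by the relation: $f\sim g$ iff $f(0)=g(0)$ and $h\circ f-h\circ g\in I$ for every smooth $h:X\to\mathbb R$. The space $X$ is Weil exponentiable if $(X\otimes(W_1\otimes_\infty W_2))^Y\cong (X\otimes W_1)^Y\otimes W_2$ in $\mathbf{FS}$, naturally in the Frölicher space $Y$ and the Weil algebras $W_1,W_2$; $\mathbf{FS}_{\mathbf{WE}}$ is the full subcategory of $\mathbf{FS}$ on these spaces. $\mathbf D$ is the full subcategory of the category of $C^\infty$-algebras on the objects $C=C^\infty(\mathbb R^n)\otimes_\infty W=C^\infty(\mathbb R^n\times\mathbb R^k)/(I)$, where $n\ge 0$ and $W=C^\infty(\mathbb R^k)/I$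 is a Weil algebra, and $X\otimes C:=X^{\mathbb R^n}\otimes W$. **Standing assumption.** For Weil exponentiable $X$, $X\otimes C$ is functorial in $C\in\mathbf D$, where a morphism $[F]\mapsto[F\circ\varphi]$ of $\mathbf D$, with $\varphi$ smooth, acts by $[f]\mapsto[f\circ\varphi]$ (the elements of $X\otimes C$ being regarded as classes of smooth mappings $f:\mathbb R^n\times\mathbb R^k\to X$); and so $(X,C)\mapsto X\otimes C$ is a bifunctor on $\mathbf{FS}_{\mathbf{WE}}\times\mathbf D$. Let $\mathbf J:\mathbf{FS}_{\mathbf{WE}}\to\mathbf{Sets}^{\mathbf D}$ be the functor for which $\mathbf J(X)(C)$ is the underlying set of $X\otimes C$. **Proposition.** Under this assumption, let $X$ and $Y$ be Weil exponentiable Frölicher spaces. Then $X^Y$ is Weil exponentiable, and there is an isomorphism $$\mathbf J(X^Y)\;\cong\;\mathbf J(X)^{\mathbf J(Y)}\qquad\text{in }\mathbf{Sets}^{\mathbf D},$$ whose transpose $\mathbf J(Y)\times\mathbf J(X^Y)\to\mathbf J(X)$ is induced by the evaluation mapping: it sends $([g],[f])$ to the class of $(t,s)\mapsto f(t,s)(g(t,s))$.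 In this sense $\mathbf J$ preserves exponentials. -/

import Mathlib

open CategoryTheory
open scoped ContDiff MonoidalCategory

noncomputable section

/-! ### Frölicher spaces -/

/-- A Frölicher space: a set with a set of smooth curves and a set of smooth functions, each of
which determines the other. -/
structure FrolicherSpace where
  carrier : Type
  curves : Set (ℝ → carrier)
  functions : Set (carrier → ℝ)
  mem_curves_iff : ∀ c, c ∈ curves ↔ ∀ h ∈ functions, ContDiff ℝ ∞ (h ∘ c)
  mem_functions_iff : ∀ h, h ∈ functions ↔ ∀ c ∈ curves, ContDiff ℝ ∞ (h ∘ c)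

namespace FrolicherSpace

/-- Smooth mappings: the maps that send smooth curves to smooth curves. -/
@[ext]
structure Hom (X Y : FrolicherSpace) where
  toFun : X.carrier → Y.carrier
  smooth : ∀ c ∈ X.curves, toFun ∘ c ∈ Y.curves

instance (X Y : FrolicherSpace) : CoeFun (Hom X Y) (fun _ => X.carrier → Y.carrier) :=
  ⟨Hom.toFun⟩

/-- The category `FS` of Frölicher spaces and smooth mappings. -/
instance : Category FrolicherSpace where
  Hom := Hom
  id X := ⟨id, fun _ hc => hc⟩
  comp f g := ⟨g.toFun ∘ f.toFun, fun c hc => g.smooth _ (f.smooth c hc)⟩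

/-- The Frölicher structure generated by a set of curves. -/
def generate (A : Type) (C₀ : Set (ℝ → A)) : FrolicherSpace where
  carrier := A
  curves := {c | ∀ h : A → ℝ, (∀ c₀ ∈ C₀, ContDiff ℝ ∞ (h ∘ c₀)) → ContDiff ℝ ∞ (h ∘ c)}
  functions := {h | ∀ c₀ ∈ C₀, ContDiff ℝ ∞ (h ∘ c₀)}
  mem_curves_iff _ := Iff.rfl
  mem_functions_iff h :=
    ⟨fun hh _ hc => hc h hh, fun hh c₀ hc₀ => hh c₀ fun _ hh' => hh' c₀ hc₀⟩

theorem subset_generate {A : Type} {C₀ : Set (ℝ → A)} {c : ℝ → A} (hc : c ∈ C₀) :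
    c ∈ (generate A C₀).curves := fun _ hh => hh c hc

/-- A map out of a generated space is smooth as soon as it is smooth along the generators. -/
theorem smooth_of_generators {A : Type} {C₀ : Set (ℝ → A)} {Y : FrolicherSpace}
    (f : A → Y.carrier) (hf : ∀ c ∈ C₀, f ∘ c ∈ Y.curves) :
    ∀ c ∈ (generate A C₀).curves, f ∘ c ∈ Y.curves := by
  intro c hc
  rw [Y.mem_curves_iff]
  intro h hh
  exact hc (h ∘ f) fun c₀ hc₀ => (Y.mem_curves_iff _).1 (hf c₀ hc₀) h hh

/-- The standard Frölicher space `ℝⁿ`. -/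
def Rn (n : ℕ) : FrolicherSpace :=
  generate (Fin n → ℝ) {c | ContDiff ℝ ∞ c}

/-- A `C^∞` map between Euclidean spaces is a smooth mapping of Frölicher spaces. -/
def RnMap {n m : ℕ} (φ : (Fin n → ℝ) → (Fin m → ℝ)) (hφ : ContDiff ℝ ∞ φ) : Rn n ⟶ Rn m :=
  ⟨φ, smooth_of_generators (Y := Rn m) φ fun _ hc => subset_generate (hφ.comp hc)⟩

/-- The exponential `X ^ Y`: the set of smooth mappings `Y → X` with the structure generated by
those curves `c` for which `(s, y) ↦ c s y` is a smooth mapping `ℝ × Y → X`, i.e. is smooth along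
every curve `s ↦ (a s, d s)` of the product Frölicher space `ℝ × Y`. -/
def exp (X Y : FrolicherSpace) : FrolicherSpace :=
  generate (Hom Y X)
    {c | ∀ a : ℝ → ℝ, ContDiff ℝ ∞ a → ∀ d ∈ Y.curves, (fun s => c (a s) (d s)) ∈ X.curves}

/-- Evaluation of an element of `X ^ Y` at an element of `Y`. -/
def ev {X Y : FrolicherSpace} (u : (exp X Y).carrier) (y : Y.carrier) : X.carrier :=
  Hom.toFun u y

/-- Functoriality of the exponential `X ^ Y`, covariant in `X` and contravariant in `Y`. -/
def expMap {X X' Y Y' : FrolicherSpace} (f : X ⟶ X') (g : Y' ⟶ Y) : exp X Y ⟶ exp X' Y' :=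
  ⟨fun u => (g ≫ u ≫ f : Y' ⟶ X'), by
    refine smooth_of_generators (Y := exp X' Y') _ fun c hc => subset_generate ?_
    intro a ha d hd
    exact f.smooth _ (hc a ha (g.toFun ∘ d) (g.smooth d hd))⟩

end FrolicherSpace

open FrolicherSpace

/-! ### Rings of smooth functions and Weil algebras -/

/-- The ring `C^∞(E)` of smooth real functions on a normed space `E`. -/
def SmoothFun (E : Type) [NormedAddCommGroup E] [NormedSpace ℝ E] : Subalgebra ℝ (E → ℝ) where
  carrier := {F | ContDiff ℝ ∞ F}
  mul_mem' {F G} hF hG := by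
    have hF' : ContDiff ℝ ∞ F := hF
    exact hF'.mul hG
  add_mem' {F G} hF hG := by
    have hF' : ContDiff ℝ ∞ F := hF
    exact hF'.add hG
  algebraMap_mem' r := (contDiff_const : ContDiff ℝ ∞ fun _ : E => r)

namespace SmoothFun

variable {E E' : Type} [NormedAddCommGroup E] [NormedSpace ℝ E]
  [NormedAddCommGroup E'] [NormedSpace ℝ E']

theorem isSmooth (F : SmoothFun E) : ContDiff ℝ ∞ F.1 := F.2

/-- Substitution of a smooth map, as a homomorphism `C^∞(E') → C^∞(E)`. -/
def pullback (φ : E → E') (hφ : ContDiff ℝ ∞ φ) : SmoothFun E' →ₐ[ℝ] SmoothFun E where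
  toFun F := ⟨F.1 ∘ φ, (isSmooth F).comp hφ⟩
  map_one' := rfl
  map_mul' _ _ := rfl
  map_zero' := rfl
  map_add' _ _ := rfl
  commutes' _ := rfl

/-- The coordinate functions on `ℝᵏ`. -/
def coord {k : ℕ} (i : Fin k) : SmoothFun (Fin k → ℝ) :=
  ⟨fun x => x i, (contDiff_apply ℝ ℝ i : ContDiff ℝ ∞ fun x : Fin k → ℝ => x i)⟩

/-- The function `x ↦ u (a₁ x, …, aₚ x)`. -/
def subst {p : ℕ} (u : SmoothFun (Fin p → ℝ)) (a : Fin p → SmoothFun E) : SmoothFun E :=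
  pullback (fun x i => (a i).1 x) (contDiff_pi.2 fun i => isSmooth (a i)) u

end SmoothFun

open SmoothFun

/-- A Weil algebra `W = C^∞(ℝᵏ) / I`, presented by an ideal `I` that is contained in the
maximal ideal of functions vanishing at `0` and contains a power of that ideal (which is generated
by the coordinates). -/
structure WeilAlgebra where
  k : ℕ
  I : Ideal (SmoothFun (Fin k → ℝ))
  vanish : ∀ F ∈ I, F.1 0 = 0
  nilpotent : ∃ r : ℕ, Ideal.span (Set.range (coord (k := k))) ^ r ≤ I

namespace WeilAlgebra

/-- The first projection `ℝ^(k+l) → ℝᵏ`. -/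
def prFst (k l : ℕ) (x : Fin (k + l) → ℝ) : Fin k → ℝ := fun i => x (Fin.castAdd l i)

/-- The second projection `ℝ^(k+l) → ℝˡ`. -/
def prSnd (k l : ℕ) (x : Fin (k + l) → ℝ) : Fin l → ℝ := fun i => x (Fin.natAdd k i)

theorem contDiff_prFst (k l : ℕ) : ContDiff ℝ ∞ (prFst k l) :=
  contDiff_pi.2 fun i => contDiff_apply ℝ ℝ (Fin.castAdd l i)

theorem contDiff_prSnd (k l : ℕ) : ContDiff ℝ ∞ (prSnd k l) :=
  contDiff_pi.2 fun i => contDiff_apply ℝ ℝ (Fin.natAdd k i)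

/-- The tensor product `W₁ ⊗_∞ W₂ = C^∞(ℝᵏ × ℝˡ) / (I₁, I₂)` of Weil algebras. -/
def tensor (W₁ W₂ : WeilAlgebra) : WeilAlgebra where
  k := W₁.k + W₂.k
  I := W₁.I.map (pullback _ (contDiff_prFst W₁.k W₂.k)) ⊔
    W₂.I.map (pullback _ (contDiff_prSnd W₁.k W₂.k))
  vanish := by
    have key : W₁.I.map (pullback _ (contDiff_prFst W₁.k W₂.k)) ⊔
        W₂.I.map (pullback _ (contDiff_prSnd W₁.k W₂.k)) ≤
        RingHom.ker ((Pi.evalRingHom (fun _ : Fin (W₁.k + W₂.k) → ℝ => ℝ) 0).comp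
          (SmoothFun (Fin (W₁.k + W₂.k) → ℝ)).val.toRingHom) := by
      refine sup_le (Ideal.map_le_iff_le_comap.2 ?_) (Ideal.map_le_iff_le_comap.2 ?_)
      · intro F hF
        exact W₁.vanish F hF
      · intro F hF
        exact W₂.vanish F hF
    exact fun F hF => key hF
  nilpotent := by
    obtain ⟨r₁, h₁⟩ := W₁.nilpotent
    obtain ⟨r₂, h₂⟩ := W₂.nilpotent
    refine ⟨r₁ + r₂, ?_⟩
    have hs : Ideal.span (Set.range (coord (k := W₁.k + W₂.k))) ≤
        (Ideal.span (Set.range (coord (k := W₁.k)))).map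
            (pullback _ (contDiff_prFst W₁.k W₂.k)) ⊔
          (Ideal.span (Set.range (coord (k := W₂.k)))).map
            (pullback _ (contDiff_prSnd W₁.k W₂.k)) := by
      rw [Ideal.span_le]
      rintro _ ⟨i, rfl⟩
      refine Fin.addCases (fun j => ?_) (fun j => ?_) i
      · exact Ideal.mem_sup_left
          (Ideal.mem_map_of_mem (pullback _ (contDiff_prFst W₁.k W₂.k))
            (Ideal.subset_span (Set.mem_range_self j)))
      · exact Ideal.mem_sup_right
          (Ideal.mem_map_of_mem (pullback _ (contDiff_prSnd W₁.k W₂.k))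
            (Ideal.subset_span (Set.mem_range_self j)))
    refine (Ideal.pow_right_mono hs _).trans (Ideal.sup_pow_add_le_pow_sup_pow.trans ?_)
    rw [← Ideal.map_pow, ← Ideal.map_pow]
    exact sup_le_sup (Ideal.map_mono h₁) (Ideal.map_mono h₂)

/-- A smooth map `φ : ℝᵏ' → ℝᵏ` whose substitution `F ↦ F ∘ φ` carries `I` into `I'`. Such maps
represent the homomorphisms of Weil algebras `C^∞(ℝᵏ)/I → C^∞(ℝᵏ')/I'`, and every homomorphism
has a representative. -/
structure Map (W W' : WeilAlgebra) where
  φ : (Fin W'.k → ℝ) → (Fin W.k → ℝ)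
  contDiff : ContDiff ℝ ∞ φ
  map_le : ∀ F ∈ W.I, pullback φ contDiff F ∈ W'.I

theorem Map.map_zero {W W' : WeilAlgebra} (φ : Map W W') : φ.φ 0 = 0 := by
  obtain ⟨r, hr⟩ := W.nilpotent
  funext i
  have h1 : coord i ^ r ∈ W.I := hr (Ideal.pow_mem_pow (Ideal.subset_span (Set.mem_range_self i)) r)
  have h2 := W'.vanish _ (φ.map_le _ h1)
  have h3 : (φ.φ 0 i) ^ r = 0 := h2
  exact eq_zero_of_pow_eq_zero h3

/-- The identity of a Weil algebra. -/
def Map.refl (W : WeilAlgebra) : Map W W := ⟨id, contDiff_id, fun _ hF => hF⟩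

/-- The map `φ₁ ⊗_∞ φ₂`. -/
def Map.tensor {W₁ W₁' W₂ W₂' : WeilAlgebra} (φ₁ : Map W₁ W₁') (φ₂ : Map W₂ W₂') :
    Map (W₁.tensor W₂) (W₁'.tensor W₂') where
  φ x := Fin.append (φ₁.φ (prFst _ _ x)) (φ₂.φ (prSnd _ _ x))
  contDiff := by
    refine contDiff_pi.2 fun i => ?_
    refine Fin.addCases (fun j => ?_) (fun j => ?_) i
    · simp only [Fin.append_left]
      exact contDiff_pi.1 (φ₁.contDiff.comp (contDiff_prFst W₁'.k W₂'.k)) j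
    · simp only [Fin.append_right]
      exact contDiff_pi.1 (φ₂.contDiff.comp (contDiff_prSnd W₁'.k W₂'.k)) j
  map_le := by
    refine fun F hF => (?_ : (W₁.tensor W₂).I ≤ Ideal.comap (pullback _ _) (W₁'.tensor W₂').I) hF
    refine sup_le (Ideal.map_le_iff_le_comap.2 fun G hG => ?_)
      (Ideal.map_le_iff_le_comap.2 fun G hG => ?_)
    · have h := Ideal.mem_map_of_mem (pullback _ (contDiff_prFst W₁'.k W₂'.k)) (φ₁.map_le G hG)
      refine Ideal.mem_sup_left (Eq.subst (Subtype.ext (funext fun x => ?_)) h)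
      refine congrArg G.1 (funext fun i => ?_)
      exact (Fin.append_left (φ₁.φ (prFst W₁'.k W₂'.k x)) (φ₂.φ (prSnd W₁'.k W₂'.k x)) i).symm
    · have h := Ideal.mem_map_of_mem (pullback _ (contDiff_prSnd W₁'.k W₂'.k)) (φ₂.map_le G hG)
      refine Ideal.mem_sup_right (Eq.subst (Subtype.ext (funext fun x => ?_)) h)
      refine congrArg G.1 (funext fun i => ?_)
      exact (Fin.append_right (φ₁.φ (prFst W₁'.k W₂'.k x)) (φ₂.φ (prSnd W₁'.k W₂'.k x)) i).symm

end WeilAlgebra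

/-! ### Weil prolongation and Weil exponentiability -/

/-- Smooth mappings `f, g : ℝᵏ → X` are equivalent modulo `I` if `f 0 = g 0` and
`h ∘ f - h ∘ g ∈ I` for every smooth function `h` on `X`. -/
def weilSetoid (X : FrolicherSpace) (W : WeilAlgebra) : Setoid (Rn W.k ⟶ X) where
  r f g := f.toFun (0 : Fin W.k → ℝ) = g.toFun (0 : Fin W.k → ℝ) ∧
    ∀ h ∈ X.functions, ∃ F ∈ W.I, ∀ s, F.1 s = h (f.toFun s) - h (g.toFun s)
  iseqv :=
    { refl := fun f => ⟨rfl, fun h _ => ⟨0, W.I.zero_mem, fun s => (sub_self _).symm⟩⟩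
      symm := fun {f g} H => ⟨H.1.symm, fun h hh => by
        obtain ⟨F, hF, e⟩ := H.2 h hh
        refine ⟨-F, W.I.neg_mem hF, fun s => ?_⟩
        change -(F.1 s) = _
        rw [e, neg_sub]⟩
      trans := fun {f g k} H K => ⟨H.1.trans K.1, fun h hh => by
        obtain ⟨F, hF, e⟩ := H.2 h hh
        obtain ⟨G, hG, e'⟩ := K.2 h hh
        refine ⟨F + G, W.I.add_mem hF hG, fun s => ?_⟩
        change F.1 s + G.1 s = _
        rw [e, e', sub_add_sub_cancel]⟩ }

/-- The Weil prolongation `X ⊗ W`: the quotient Frölicher space of `X ^ ℝᵏ` by equivalence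
modulo `I`. -/
def weilProlongation (X : FrolicherSpace) (W : WeilAlgebra) : FrolicherSpace :=
  generate (Quotient (weilSetoid X W))
    {c | ∃ d ∈ (exp X (Rn W.k)).curves, c = fun s => Quotient.mk (weilSetoid X W) (d s)}

/-- The class in `X ⊗ W` of a smooth mapping `ℝᵏ → X`. -/
def weilMk {X : FrolicherSpace} {W : WeilAlgebra} (f : Rn W.k ⟶ X) :
    (weilProlongation X W).carrier :=
  Quotient.mk (weilSetoid X W) f

/-- The action `[f] ↦ [g ∘ f ∘ φ]` of the bifunctor `⊗ : FS × W → FS` on morphisms. -/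
def weilMap {X X' : FrolicherSpace} {W W' : WeilAlgebra} (g : X ⟶ X') (φ : WeilAlgebra.Map W W') :
    weilProlongation X W ⟶ weilProlongation X' W' :=
  ⟨Quotient.map (fun f : Rn W.k ⟶ X => RnMap φ.φ φ.contDiff ≫ f ≫ g) (by
      rintro f f' ⟨h0, H⟩
      refine ⟨?_, fun h hh => ?_⟩
      · change g.toFun (f.toFun (φ.φ 0)) = g.toFun (f'.toFun (φ.φ 0))
        rw [φ.map_zero, h0]
      · have hg : h ∘ g.toFun ∈ X.functions := by
          rw [X.mem_functions_iff]
          intro c hc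
          exact (X'.mem_functions_iff h).1 hh _ (g.smooth c hc)
        obtain ⟨F, hF, e⟩ := H _ hg
        exact ⟨_, φ.map_le F hF, fun s => e (φ.φ s)⟩),
    by
      refine smooth_of_generators (Y := weilProlongation X' W') _ ?_
      rintro c ⟨d, hd, rfl⟩
      exact subset_generate ⟨_, (expMap g (RnMap φ.φ φ.contDiff)).smooth d hd, rfl⟩⟩

/-- A Frölicher space `X` is Weil exponentiable if
`(X ⊗ (W₁ ⊗_∞ W₂)) ^ Y ≅ (X ⊗ W₁) ^ Y ⊗ W₂` holds naturally in the Frölicher space `Y` and the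
Weil algebras `W₁`, `W₂`. -/
def WeilExponentiable : ObjectProperty FrolicherSpace := fun X =>
  ∃ θ : ∀ (Y : FrolicherSpace) (W₁ W₂ : WeilAlgebra),
      exp (weilProlongation X (W₁.tensor W₂)) Y ≅ weilProlongation (exp (weilProlongation X W₁) Y) W₂,
    ∀ (Y Y' : FrolicherSpace) (g : Y' ⟶ Y) (W₁ W₁' W₂ W₂' : WeilAlgebra)
      (φ₁ : WeilAlgebra.Map W₁ W₁') (φ₂ : WeilAlgebra.Map W₂ W₂'),
      (θ Y W₁ W₂).hom ≫ weilMap (expMap (weilMap (𝟙 X) φ₁) g) φ₂ =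
        expMap (weilMap (𝟙 X) (φ₁.tensor φ₂)) g ≫ (θ Y' W₁' W₂').hom

/-- The category `FS_WE`, a full subcategory of `FS`. -/
abbrev FSWE := WeilExponentiable.FullSubcategory

/-! ### Hadamard's lemma -/

theorem contDiff_integral_nat {P : Type} [NormedAddCommGroup P] [NormedSpace ℝ P] [ProperSpace P]
    (n : ℕ) : ∀ {F : Type} [NormedAddCommGroup F] [NormedSpace ℝ F] [CompleteSpace F]
      (f : P × ℝ → F), ContDiff ℝ n f → ContDiff ℝ n (fun x => ∫ t in (0 : ℝ)..1, f (x, t)) := by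
  induction n with
  | zero =>
    intro F _ _ _ f hf
    rw [Nat.cast_zero, contDiff_zero] at *
    exact intervalIntegral.continuous_parametric_intervalIntegral_of_continuous' (by exact hf) 0 1
  | succ n ih =>
    intro F _ _ _ f hf
    have hf1 : ContDiff ℝ 1 f := hf.of_le (by simp)
    have hd : Differentiable ℝ f := hf1.differentiable (by simp)
    have hf' : ContDiff ℝ n (fun q : P × ℝ => (fderiv ℝ f q).comp (ContinuousLinearMap.inl ℝ P ℝ)) :=
      (hf.fderiv_right (m := n) (by simp)).clm_comp contDiff_const
    push_cast
    rw [contDiff_succ_iff_hasFDerivAt]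
    refine ⟨_, ih _ hf', fun x => ?_⟩
    have hc := hf'.continuous
    obtain ⟨C, hC⟩ := ((isCompact_closedBall x 1).prod
      (isCompact_Icc (a := (0 : ℝ)) (b := 1))).exists_bound_of_continuousOn hc.continuousOn
    refine (intervalIntegral.hasFDerivAt_integral_of_dominated_of_fderiv_le
      (bound := fun _ => C) (F' := fun x t => (fderiv ℝ f (x, t)).comp (ContinuousLinearMap.inl ℝ P ℝ)) (Metric.closedBall_mem_nhds x one_pos) (Filter.Eventually.of_forall fun y => ?_) ?_ ?_ ?_ ?_ ?_)
    · exact (hd.continuous.comp (by fun_prop : Continuous fun t : ℝ => (y, t))).aestronglyMeasurable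
    · exact (hd.continuous.comp (by fun_prop : Continuous fun t : ℝ => (x, t))).intervalIntegrable _ _
    · exact (hc.comp (by fun_prop : Continuous fun t : ℝ => (x, t))).aestronglyMeasurable
    · refine Filter.Eventually.of_forall fun t ht y hy => hC (y, t) ⟨hy, ?_⟩
      rw [Set.uIoc_of_le zero_le_one] at ht
      exact ⟨ht.1.le, ht.2⟩
    · exact intervalIntegrable_const
    · refine Filter.Eventually.of_forall fun t _ y _ => ?_
      exact (hd (y, t)).hasFDerivAt.comp y (hasFDerivAt_prodMk_left y t)

theorem contDiff_integral {P : Type} [NormedAddCommGroup P] [NormedSpace ℝ P] [ProperSpace P]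
    (f : P × ℝ → ℝ) (hf : ContDiff ℝ ∞ f) :
    ContDiff ℝ ∞ (fun x => ∫ t in (0 : ℝ)..1, f (x, t)) := by
  rw [contDiff_infty] at *
  exact fun n => contDiff_integral_nat n f (hf n)

/-- Hadamard's lemma. -/
theorem exists_hadamard {p : ℕ} (u : (Fin p → ℝ) → ℝ) (hu : ContDiff ℝ ∞ u) :
    ∃ g : Fin p → (Fin p → ℝ) × (Fin p → ℝ) → ℝ, (∀ i, ContDiff ℝ ∞ (g i)) ∧
      ∀ y z, u y - u z = ∑ i, g i (y, z) * (y i - z i) := by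
  have hγ : ContDiff ℝ ∞ fun q : ((Fin p → ℝ) × (Fin p → ℝ)) × ℝ =>
      q.1.2 + q.2 • (q.1.1 - q.1.2) := by fun_prop
  have hF : ∀ i, ContDiff ℝ ∞ fun q : ((Fin p → ℝ) × (Fin p → ℝ)) × ℝ =>
      fderiv ℝ u (q.1.2 + q.2 • (q.1.1 - q.1.2)) (Pi.single i 1) := fun i =>
    ((hu.fderiv_right (m := ∞) (by simp)).comp hγ).clm_apply contDiff_const
  refine ⟨_, fun i => contDiff_integral _ (hF i), fun y z => ?_⟩
  have hd : ∀ t : ℝ, HasDerivAt (fun t : ℝ => u (z + t • (y - z)))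
      (fderiv ℝ u (z + t • (y - z)) (y - z)) t := fun t => by
    have h1 : HasDerivAt (fun t : ℝ => z + t • (y - z)) (y - z) t := by
      simpa using ((hasDerivAt_id t).smul_const (y - z)).const_add z
    exact (hu.differentiable (by simp) _).hasFDerivAt.comp_hasDerivAt t h1
  have hcont : ∀ i, Continuous fun t : ℝ => fderiv ℝ u (z + t • (y - z)) (Pi.single i 1) :=
    fun i => (hF i).continuous.comp (by fun_prop : Continuous fun t : ℝ => ((y, z), t))
  have hexp : ∀ t : ℝ, fderiv ℝ u (z + t • (y - z)) (y - z) =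
      ∑ i, fderiv ℝ u (z + t • (y - z)) (Pi.single i 1) * (y i - z i) := fun t => by
    have h1 := congrArg (fderiv ℝ u (z + t • (y - z))) (pi_eq_sum_univ' (y - z))
    rw [h1, map_sum]
    refine Finset.sum_congr rfl fun i _ => ?_
    rw [map_smul, smul_eq_mul, mul_comm]
    rfl
  have h2 := intervalIntegral.integral_eq_sub_of_hasDerivAt (a := 0) (b := 1) (fun t _ => hd t) (by
    simp_rw [hexp]
    exact Continuous.intervalIntegrable (by fun_prop) _ _)
  simp_rw [hexp] at h2
  have h3 : ∀ i ∈ Finset.univ, IntervalIntegrable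
      (fun t : ℝ => fderiv ℝ u (z + t • (y - z)) (Pi.single i 1) * (y i - z i))
      MeasureTheory.volume 0 1 :=
    fun i _ => ((hcont i).mul continuous_const).intervalIntegrable _ _
  rw [intervalIntegral.integral_finsetSum h3] at h2
  simp_rw [intervalIntegral.integral_mul_const] at h2
  simpa using h2.symm

/-! ### `C^∞`-algebras and the category `D` -/

/-- A `C^∞`-algebra: a set on which the smooth functions `ℝᵖ → ℝ` operate, compatibly with
projections and composition. -/
structure CInfAlgebra where
  carrier : Type
  op : ∀ {p : ℕ}, SmoothFun (Fin p → ℝ) → (Fin p → carrier) → carrier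
  op_coord : ∀ {p : ℕ} (i : Fin p) (a : Fin p → carrier), op (coord i) a = a i
  op_subst : ∀ {p q : ℕ} (u : SmoothFun (Fin p → ℝ)) (v : Fin p → SmoothFun (Fin q → ℝ))
    (a : Fin q → carrier), op u (fun i => op (v i) a) = op (subst u v) a

/-- Homomorphisms of `C^∞`-algebras. -/
@[ext]
structure CInfAlgebra.Hom (A B : CInfAlgebra) where
  toFun : A.carrier → B.carrier
  map_op : ∀ {p : ℕ} (u : SmoothFun (Fin p → ℝ)) (a : Fin p → A.carrier),
    toFun (A.op u a) = B.op u (fun i => toFun (a i))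

instance : Category CInfAlgebra where
  Hom := CInfAlgebra.Hom
  id A := ⟨id, fun _ _ => rfl⟩
  comp f g := ⟨g.toFun ∘ f.toFun, fun u a => by
    change g.toFun (f.toFun _) = _
    rw [f.map_op, g.map_op]; rfl⟩

theorem mk_subst_congr {E : Type} [NormedAddCommGroup E] [NormedSpace ℝ E]
    (J : Ideal (SmoothFun E)) {p : ℕ} (u : SmoothFun (Fin p → ℝ)) {a b : Fin p → SmoothFun E}
    (hab : ∀ i, Ideal.Quotient.mk J (a i) = Ideal.Quotient.mk J (b i)) :
    Ideal.Quotient.mk J (subst u a) = Ideal.Quotient.mk J (subst u b) := by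
  obtain ⟨g, hg, e⟩ := exists_hadamard u.1 (isSmooth u)
  have ha : ContDiff ℝ ∞ fun x => (fun i => (a i).1 x) := contDiff_pi.2 fun i => isSmooth (a i)
  have hb : ContDiff ℝ ∞ fun x => (fun i => (b i).1 x) := contDiff_pi.2 fun i => isSmooth (b i)
  rw [Ideal.Quotient.mk_eq_mk_iff_sub_mem]
  have key : subst u a - subst u b =
      ∑ i, (⟨_, (hg i).comp (ha.prodMk hb)⟩ : SmoothFun E) * (a i - b i) := by
    apply Subtype.ext
    funext x
    have h1 := e (fun i => (a i).1 x) (fun i => (b i).1 x)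
    rw [AddSubmonoidClass.coe_finsetSum, Finset.sum_apply]
    exact h1
  rw [key]
  exact J.sum_mem fun i _ => J.mul_mem_left _ ((Ideal.Quotient.mk_eq_mk_iff_sub_mem _ _).1 (hab i))

/-- The `C^∞`-algebra `C^∞(E) / J`, with the operations induced from representatives. -/
def CInfAlgebra.ofIdeal {E : Type} [NormedAddCommGroup E] [NormedSpace ℝ E]
    (J : Ideal (SmoothFun E)) : CInfAlgebra where
  carrier := SmoothFun E ⧸ J
  op u a := Ideal.Quotient.mk J (subst u fun i => (a i).out)
  op_coord i a := by
    conv_rhs => rw [← Ideal.Quotient.mk_out (a i)]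
    rfl
  op_subst {p q} u v a := by
    exact mk_subst_congr J u (b := fun i => subst (v i) fun j => (a j).out) fun i =>
      Ideal.Quotient.mk_out _

/-- An object `C^∞(ℝⁿ) ⊗_∞ W` of the category `D`. -/
structure DObj where
  n : ℕ
  W : WeilAlgebra

namespace DObj

/-- The ideal of `C^∞(ℝⁿ × ℝᵏ)` generated by `I`, for `W = C^∞(ℝᵏ) / I`. -/
def ideal (C : DObj) : Ideal (SmoothFun ((Fin C.n → ℝ) × (Fin C.W.k → ℝ))) :=
  C.W.I.map (pullback Prod.snd contDiff_snd)

/-- The `C^∞`-algebra `C^∞(ℝⁿ) ⊗_∞ W = C^∞(ℝⁿ × ℝᵏ) / (I)`. -/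
def toCInfAlgebra (C : DObj) : CInfAlgebra := CInfAlgebra.ofIdeal C.ideal

/-- `D` as a full subcategory of the category of `C^∞`-algebras. -/
instance : Category.{0} DObj :=
  inferInstanceAs (Category (InducedCategory CInfAlgebra toCInfAlgebra))

/-- The homomorphism `ψ` is the substitution `[F] ↦ [F ∘ φ]`. Every morphism of `D` is of this form. -/
def IsSubst {C C' : DObj} (ψ : C ⟶ C')
    (φ : (Fin C'.n → ℝ) × (Fin C'.W.k → ℝ) → (Fin C.n → ℝ) × (Fin C.W.k → ℝ))
    (hφ : ContDiff ℝ ∞ φ) : Prop :=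
  ∀ F, ψ.hom.toFun (Ideal.Quotient.mk C.ideal F) = Ideal.Quotient.mk C'.ideal (pullback φ hφ F)

end DObj

/-! ### The bifunctor `FS_WE × D → FS_WE` and the functor `J` -/

/-- `X ⊗ C = X ^ ℝⁿ ⊗ W` for `C = C^∞(ℝⁿ) ⊗_∞ W`. -/
def prolong (X : FrolicherSpace) (C : DObj) : FrolicherSpace :=
  weilProlongation (exp X (Rn C.n)) C.W

/-- Functoriality of `X ⊗ C` in `X`. -/
def prolongMap {X X' : FrolicherSpace} (g : X ⟶ X') (C : DObj) : prolong X C ⟶ prolong X' C :=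
  weilMap (expMap g (𝟙 (Rn C.n))) (WeilAlgebra.Map.refl C.W)

/-- The class in `X ⊗ C` of a smooth mapping `f : ℝᵏ → X ^ ℝⁿ`. -/
def prolongMk {X : FrolicherSpace} (C : DObj) (f : Hom (Rn C.W.k) (exp X (Rn C.n))) :
    (prolong X C).carrier :=
  weilMk (X := exp X (Rn C.n)) (W := C.W) f

/-- The value at `(t, s) ∈ ℝⁿ × ℝᵏ` of a smooth mapping `f : ℝᵏ → X ^ ℝⁿ`. -/
def value {X : FrolicherSpace} {n k : ℕ} (f : Hom (Rn k) (exp X (Rn n))) (t : Fin n → ℝ)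
    (s : Fin k → ℝ) : X.carrier :=
  ev (f.toFun s) t

/-- Functoriality of `X ⊗ C` in `C ∈ D`: the morphism `[F] ↦ [F ∘ φ]` of `D` acts by
`[f] ↦ [f ∘ φ]`, and this makes `⊗` a bifunctor on `FS_WE × D`. There is at most one such structure, and
that it exists is the assumption that `X ⊗ C` is functorial in `C`. -/
structure FunctorialInD where
  map : ∀ (X : FSWE) {C C' : DObj}, (C ⟶ C') → (prolong X.obj C ⟶ prolong X.obj C')
  map_subst : ∀ (X : FSWE) {C C' : DObj} (ψ : C ⟶ C')
    (φ : (Fin C'.n → ℝ) × (Fin C'.W.k → ℝ) → (Fin C.n → ℝ) × (Fin C.W.k → ℝ))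
    (hφ : ContDiff ℝ ∞ φ), DObj.IsSubst ψ φ hφ →
    ∀ (f : Hom (Rn C.W.k) (exp X.obj (Rn C.n))) (f' : Hom (Rn C'.W.k) (exp X.obj (Rn C'.n))),
      (∀ t s, value f' t s = value f (φ (t, s)).1 (φ (t, s)).2) →
      (map X ψ).toFun (prolongMk C f) = prolongMk C' f'
  map_id : ∀ (X : FSWE) (C : DObj), map X (𝟙 C) = 𝟙 _
  map_comp : ∀ (X : FSWE) {C C' C'' : DObj} (ψ : C ⟶ C') (χ : C' ⟶ C''),
    map X (ψ ≫ χ) = map X ψ ≫ map X χ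
  natural : ∀ {X X' : FSWE} (g : X ⟶ X') {C C' : DObj} (ψ : C ⟶ C'),
    prolongMap g.hom C ≫ map X' ψ = map X ψ ≫ prolongMap g.hom C'

theorem prolongMap_id (X : FrolicherSpace) (C : DObj) : prolongMap (𝟙 X) C = 𝟙 _ := by
  apply Hom.ext
  funext z
  induction z using Quotient.inductionOn
  rfl

theorem prolongMap_comp {X X' X'' : FrolicherSpace} (g : X ⟶ X') (g' : X' ⟶ X'') (C : DObj) :
    prolongMap (g ≫ g') C = prolongMap g C ≫ prolongMap g' C := by
  apply Hom.ext
  funext z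
  induction z using Quotient.inductionOn
  rfl

/-- The functor `J : FS_WE → Sets^D`, the exponential adjoint of
`FS_WE × D → FS_WE → Sets`, `(X, C) ↦ X ⊗ C`. -/
def J (T : FunctorialInD) : FSWE ⥤ (DObj ⥤ Type) where
  obj X :=
    { obj := fun C => (prolong X.obj C).carrier
      map := fun ψ => ↾(T.map X ψ).toFun
      map_id := fun C => by rw [T.map_id]; rfl
      map_comp := fun ψ χ => by rw [T.map_comp]; rfl }
  map g :=
    { app := fun C => ↾(prolongMap g.hom C).toFun
      naturality := fun C C' ψ => by
        ext z
        exact (congrFun (congrArg Hom.toFun (T.natural g ψ)) z).symm }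
  map_id X := by
    ext C z
    exact congrFun (congrArg Hom.toFun (prolongMap_id X.obj C)) z
  map_comp g g' := by
    ext C z
    exact congrFun (congrArg Hom.toFun (prolongMap_comp g.hom g'.hom C)) z

/-! The analytic core is cartesian closedness. A Frölicher exponential `X ^ Y` is generated by the
curves that are smooth as mappings `ℝ × Y → X`, and generating adds no further curves
(`mem_exp_curves`). This rests on Boman's theorem in the plane (`SmoothAlongCurves.contDiff`) and on
`contDiff_of_functionals`, by which a curve of smooth functions is jointly smooth once enough
functionals of it are smooth. The exponential law `curryIso` follows.

For Weil exponentiable `X`, the case `W₁ = ℝ` gives some isomorphism `(X ⊗ W) ^ Y ≅ X ^ Y ⊗ W`,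
natural in `Y`. Naturality along the points of `Y` shows that its composite with the canonical
mapping `weilExpComparison` is `η ^ Y` for an automorphism `η` of `X ⊗ W`. Hence the canonical
mapping is itself an isomorphism, and with the exponential law `X ^ Y` is Weil exponentiable.

Evaluation is well defined on classes: with either argument fixed, it is induced by a smooth mapping
into `X ^ (ℝⁿ × ℝᵏ)` followed by restriction to a diagonal, which is a morphism of `D`
(`diag_congr`).

Let `C = C^∞(ℝⁿ) ⊗_∞ W`. By naturality an element of `(J X ^ J Y) (C)` is determined by its values
at points of `ℝⁿ` and constant elements of `Y` (`ext_of_pointValue`), and these values form a smooth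
mapping `ℝⁿ × Y → X ⊗ W` (`pointValueHom`). Through the canonical isomorphism such mappings are the
elements of `X ^ (ℝⁿ × Y) ⊗ W ≅ X ^ Y ⊗ C`. So the transpose of evaluation is bijective at every
`C`. -/

section

open Filter Topology

/-! ### Smoothness criteria -/


/-- A family of curves that is closed under differentiation consists of smooth curves. -/
theorem contDiff_of_deriv_closed {E : Type*} [NormedAddCommGroup E] [NormedSpace ℝ E]
    (S : Set (ℝ → E)) (hS : ∀ c ∈ S, ∃ c' ∈ S, ∀ t, HasDerivAt c (c' t) t) :
    ∀ c ∈ S, ContDiff ℝ ∞ c := by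
  intro c hc
  rw [contDiff_infty]
  intro n
  induction n generalizing c with
  | zero =>
    obtain ⟨c', -, h⟩ := hS c hc
    exact contDiff_zero.2 (continuous_iff_continuousAt.2 fun t => (h t).continuousAt)
  | succ n ih =>
    obtain ⟨c', hc', h⟩ := hS c hc
    push_cast
    rw [contDiff_succ_iff_deriv]
    refine ⟨fun t => (h t).differentiableAt, fun h => absurd h (by simp), ?_⟩
    rw [show deriv c = c' from funext fun t => (h t).deriv]
    exact ih c' hc'

/-- A family of functions of two variables that is closed under partial differentiation and
consists of continuous functions consists of smooth functions. -/
theorem contDiffOn_of_partials_closed {U : Set (ℝ × ℝ)} (hU : IsOpen U) (S : Set (ℝ → ℝ → ℝ))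
    (hc : ∀ G ∈ S, ContinuousOn (fun p : ℝ × ℝ => G p.1 p.2) U)
    (hS : ∀ G ∈ S, ∃ G₁ ∈ S, ∃ G₂ ∈ S, ∀ p ∈ U, HasDerivAt (fun s => G s p.2) (G₁ p.1 p.2) p.1 ∧
      HasDerivAt (fun t => G p.1 t) (G₂ p.1 p.2) p.2) :
    ∀ G ∈ S, ContDiffOn ℝ ∞ (fun p : ℝ × ℝ => G p.1 p.2) U := by
  intro G hG
  rw [contDiffOn_infty]
  intro n
  induction n generalizing G with
  | zero => exact contDiffOn_zero.2 (hc G hG)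
  | succ n ih =>
    obtain ⟨G₁, hG₁, G₂, hG₂, h⟩ := hS G hG
    have hd : ∀ p ∈ U, HasFDerivAt (fun p : ℝ × ℝ => G p.1 p.2)
        ((ContinuousLinearMap.toSpanSingleton ℝ (G₁ p.1 p.2)).coprod
          (ContinuousLinearMap.toSpanSingleton ℝ (G₂ p.1 p.2))) p := by
      intro p hp
      have hUp := hU.mem_nhds hp
      have hcl : Continuous fun r : ℝ => (ContinuousLinearMap.toSpanSingleton ℝ r : ℝ →L[ℝ] ℝ) :=
        (ContinuousLinearMap.toSpanSingletonCLE (𝕜 := ℝ) (E := ℝ)).continuous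
      -- Partial derivatives near `p` that are continuous at `p` give joint differentiability; their
      -- continuity is `hc` for `G₁` and `G₂`.
      exact (hasStrictFDerivAt_uncurry_coprod (u := p) (f := G)
        (f₁ := fun s t => ContinuousLinearMap.toSpanSingleton ℝ (G₁ s t))
        (f₂ := fun s t => ContinuousLinearMap.toSpanSingleton ℝ (G₂ s t))
        (by filter_upwards [hUp] with v hv using (h v hv).1.hasFDerivAt)
        (by filter_upwards [hUp] with v hv using (h v hv).2.hasFDerivAt)
        (hcl.continuousAt.comp ((hc G₁ hG₁).continuousAt hUp))
        (hcl.continuousAt.comp ((hc G₂ hG₂).continuousAt hUp))).hasFDerivAt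
    push_cast
    rw [contDiffOn_succ_iff_fderiv_of_isOpen hU]
    refine ⟨fun p hp => (hd p hp).differentiableAt.differentiableWithinAt,
      fun h => absurd h (by simp), ?_⟩
    refine ContDiffOn.congr (f := fun p => (ContinuousLinearMap.toSpanSingleton ℝ (G₁ p.1 p.2)).coprod
          (ContinuousLinearMap.toSpanSingleton ℝ (G₂ p.1 p.2))) ?_ fun p hp => (hd p hp).fderiv
    have e : (fun p : ℝ × ℝ => (ContinuousLinearMap.toSpanSingleton ℝ (G₁ p.1 p.2)).coprod
          (ContinuousLinearMap.toSpanSingleton ℝ (G₂ p.1 p.2))) = fun p =>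
          G₁ p.1 p.2 • ContinuousLinearMap.fst ℝ ℝ ℝ + G₂ p.1 p.2 • ContinuousLinearMap.snd ℝ ℝ ℝ := by
      funext p
      ext <;> simp
    rw [e]
    exact ((ih G₁ hG₁).smul contDiffOn_const).add ((ih G₂ hG₂).smul contDiffOn_const)

/-- The second divided differences of a `C²` function are bounded. -/
theorem exists_bound_divided_difference (φ : ℝ → ℝ) (hφ : ContDiff ℝ ∞ φ) (s : ℝ) :
    ∃ C, ∀ δ δ' : ℝ, δ ≠ 0 → δ' ≠ 0 → |δ| ≤ 1 → |δ'| ≤ 1 →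
      |(φ (s + δ) - φ s) / δ - (φ (s + δ') - φ s) / δ'| ≤ C * |δ - δ'| := by
  -- The divided difference at `s` extends smoothly across `δ = 0` as the mean of `φ'` over the
  -- segment from `s` to `s + δ`. The constant is a bound for the derivative of this extension on
  -- `[-1, 1]`.
  have hq : ContDiff ℝ ∞ fun x : ℝ => ∫ t in (0 : ℝ)..1, deriv φ (s + t * x) := by
    refine contDiff_integral (fun q : ℝ × ℝ => deriv φ (s + q.2 * q.1)) ?_
    exact (hφ.iterate_deriv 1).comp (by fun_prop)
  set q : ℝ → ℝ := fun x : ℝ => ∫ t in (0 : ℝ)..1, deriv φ (s + t * x)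
  have e : ∀ δ, δ ≠ 0 → (φ (s + δ) - φ s) / δ = q δ := by
    intro δ hδ
    have h1 : ∀ t ∈ Set.uIcc (0 : ℝ) 1, HasDerivAt (fun t => φ (s + t * δ)) (deriv φ (s + t * δ) * δ) t := by
      intro t _
      have := (hφ.differentiable (by simp) (s + t * δ)).hasDerivAt.comp t
        (((hasDerivAt_id t).mul_const δ).const_add s)
      simpa [Function.comp_def] using! this
    have hcd : Continuous (deriv φ) := (hφ.iterate_deriv 1).continuous
    have h2 := intervalIntegral.integral_eq_sub_of_hasDerivAt h1
      (Continuous.intervalIntegrable (by fun_prop) _ _)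
    rw [intervalIntegral.integral_mul_const] at h2
    rw [div_eq_iff hδ]
    simpa using h2.symm
  obtain ⟨C, hC⟩ := (isCompact_Icc (a := (-1 : ℝ)) (b := 1)).exists_bound_of_continuousOn
    (f := deriv q) (hq.iterate_deriv 1).continuous.continuousOn
  refine ⟨C, fun δ δ' h0 h0' h1 h1' => ?_⟩
  rw [e δ h0, e δ' h0']
  exact (convex_Icc (-1 : ℝ) 1).norm_image_sub_le_of_norm_deriv_le
    (fun x _ => hq.differentiable (by simp) x) hC (abs_le.1 h1') (abs_le.1 h1)

/-- A curve in a Banach space is smooth if its composites with continuous linear functionals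
are smooth. -/
theorem contDiff_of_weakly_contDiff {E : Type*} [NormedAddCommGroup E] [NormedSpace ℝ E]
    [CompleteSpace E] (c : ℝ → E) (hc : ∀ l : E →L[ℝ] ℝ, ContDiff ℝ ∞ (fun s => l (c s))) :
    ContDiff ℝ ∞ c := by
  refine contDiff_of_deriv_closed {c : ℝ → E | ∀ l : E →L[ℝ] ℝ, ContDiff ℝ ∞ (fun s => l (c s))}
    ?_ c hc
  intro c hc
  have key : ∀ s, ∃ v, HasDerivAt c v s := by
    intro s
    -- The divided differences of the quotient `Q` are bounded under every functional, hence bounded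
    -- in norm by Banach–Steinhaus applied to their images in the bidual. So `Q` is Lipschitz on the
    -- punctured interval, and its limit at `0` exists by completeness.
    let Q : ℝ → E := fun δ => δ⁻¹ • (c (s + δ) - c s)
    let ι := {p : ℝ × ℝ // p.1 ≠ 0 ∧ p.2 ≠ 0 ∧ |p.1| ≤ 1 ∧ |p.2| ≤ 1 ∧ p.1 ≠ p.2}
    obtain ⟨C, hC⟩ := banach_steinhaus (𝕜 := ℝ) (𝕜₂ := ℝ) (E := StrongDual ℝ E) (F := ℝ) (ι := ι)
      (g := fun p => NormedSpace.inclusionInDoubleDual ℝ E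
        ((p.1.1 - p.1.2)⁻¹ • (Q p.1.1 - Q p.1.2))) (by
      intro l
      obtain ⟨C, hC⟩ := exists_bound_divided_difference _ (hc l) s
      refine ⟨C, fun p => ?_⟩
      obtain ⟨⟨δ, δ'⟩, h0, h0', h1, h1', hne⟩ := p
      have := hC δ δ' h0 h0' h1 h1'
      have hpos : 0 < |δ - δ'| := abs_pos.2 (sub_ne_zero.2 hne)
      rw [NormedSpace.dual_def, map_smul, norm_smul, norm_inv, Real.norm_eq_abs (δ - δ'),
        inv_mul_le_iff₀ hpos, mul_comm]
      have e : ∀ δ, l (Q δ) = (l (c (s + δ)) - l (c s)) / δ := fun δ => by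
        change l (δ⁻¹ • (c (s + δ) - c s)) = _
        rw [map_smul, map_sub, smul_eq_mul, div_eq_inv_mul]
      rw [map_sub, e, e]
      exact this)
    have hlip : ∀ δ δ' : ℝ, δ ≠ 0 → δ' ≠ 0 → |δ| ≤ 1 → |δ'| ≤ 1 →
        ‖Q δ - Q δ'‖ ≤ C * |δ - δ'| := by
      intro δ δ' h0 h0' h1 h1'
      by_cases hne : δ = δ'
      · simp [hne]
      have := hC ⟨(δ, δ'), h0, h0', h1, h1', hne⟩
      have h2 : ‖(δ - δ')⁻¹ • (Q δ - Q δ')‖ ≤ C := by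
        refine le_trans (le_of_eq ?_) this
        exact ((NormedSpace.inclusionInDoubleDualLi (𝕜 := ℝ) (E := E)).norm_map _).symm
      have hpos : 0 < |δ - δ'| := abs_pos.2 (sub_ne_zero.2 hne)
      rwa [norm_smul, norm_inv, Real.norm_eq_abs, inv_mul_le_iff₀ hpos, mul_comm] at h2
    have hcau : Cauchy (map Q (𝓝[≠] (0 : ℝ))) := by
      rw [Metric.cauchy_iff]
      refine ⟨inferInstance, fun ε hε => ?_⟩
      have hr : 0 < min 1 (ε / (4 * (|C| + 1))) := by positivity
      refine ⟨Q '' {δ | δ ≠ 0 ∧ |δ| < min 1 (ε / (4 * (|C| + 1)))}, image_mem_map ?_, ?_⟩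
      · rw [mem_nhdsWithin_iff_exists_mem_nhds_inter]
        refine ⟨Metric.ball 0 _, Metric.ball_mem_nhds 0 hr, fun x hx => ⟨hx.2, ?_⟩⟩
        simpa using hx.1
      · rintro _ ⟨x, ⟨hx0, hx⟩, rfl⟩ _ ⟨y, ⟨hy0, hy⟩, rfl⟩
        rw [dist_eq_norm]
        have h1 := hlip x y hx0 hy0 (hx.le.trans (min_le_left _ _)) (hy.le.trans (min_le_left _ _))
        have h2 : |x - y| ≤ 2 * (ε / (4 * (|C| + 1))) := by
          have := abs_sub x y
          have := hx.trans_le (min_le_right _ _)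
          have := hy.trans_le (min_le_right _ _)
          linarith
        calc ‖Q x - Q y‖ ≤ C * |x - y| := h1
          _ ≤ (|C| + 1) * |x - y| := by gcongr; linarith [le_abs_self C]
          _ ≤ (|C| + 1) * (2 * (ε / (4 * (|C| + 1)))) := by gcongr
          _ = ε / 2 := by field_simp; ring
          _ < ε := half_lt_self hε
    obtain ⟨v, hv⟩ := CompleteSpace.complete hcau
    exact ⟨v, hasDerivAt_iff_tendsto_slope_zero.2 hv⟩
  choose c' hc' using key
  refine ⟨c', fun l => ?_, hc'⟩
  have : (fun s => l (c' s)) = deriv (fun s => l (c s)) :=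
    funext fun s => (l.hasFDerivAt.comp_hasDerivAt s (hc' s)).deriv.symm
  rw [this]
  exact (hc l).iterate_deriv 1

/-! ### Smooth curves in spaces of continuous functions -/

theorem contDiff_iteratedDeriv {E : Type*} [NormedAddCommGroup E] [NormedSpace ℝ E] {f : ℝ → E}
    (hf : ContDiff ℝ ∞ f) (n : ℕ) : ContDiff ℝ ∞ (iteratedDeriv n f) := by
  rw [iteratedDeriv_eq_iterate]
  exact hf.iterate_deriv n

theorem hasDerivAt_iteratedDeriv {E : Type*} [NormedAddCommGroup E] [NormedSpace ℝ E] {f : ℝ → E}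
    (hf : ContDiff ℝ ∞ f) (n : ℕ) (x : ℝ) :
    HasDerivAt (iteratedDeriv n f) (iteratedDeriv (n + 1) f x) x := by
  rw [iteratedDeriv_succ]
  exact ((contDiff_iteratedDeriv hf n).differentiable (by simp) x).hasDerivAt

theorem hasDerivAt_fst {H : ℝ → ℝ → ℝ} (hH : ContDiff ℝ ∞ fun p : ℝ × ℝ => H p.1 p.2) (s t : ℝ) :
    HasDerivAt (fun s => H s t) (fderiv ℝ (fun p : ℝ × ℝ => H p.1 p.2) (s, t) (1, 0)) s := by
  exact ((hH.differentiable (by simp) (s, t)).hasFDerivAt).comp_hasDerivAt s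
    ((hasDerivAt_id s).prodMk (hasDerivAt_const s t))

theorem hasDerivAt_snd {H : ℝ → ℝ → ℝ} (hH : ContDiff ℝ ∞ fun p : ℝ × ℝ => H p.1 p.2) (s t : ℝ) :
    HasDerivAt (fun t => H s t) (fderiv ℝ (fun p : ℝ × ℝ => H p.1 p.2) (s, t) (0, 1)) t := by
  exact ((hH.differentiable (by simp) (s, t)).hasFDerivAt).comp_hasDerivAt t
    ((hasDerivAt_const t s).prodMk (hasDerivAt_id t))

theorem contDiff_fderiv_apply_const {H : ℝ × ℝ → ℝ} (hH : ContDiff ℝ ∞ H) (v : ℝ × ℝ) :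
    ContDiff ℝ ∞ fun p => fderiv ℝ H p v :=
  (hH.fderiv_right (m := ∞) (by simp)).clm_apply contDiff_const

theorem contDiff_iteratedDeriv_snd {H : ℝ → ℝ → ℝ} (hH : ContDiff ℝ ∞ fun p : ℝ × ℝ => H p.1 p.2)
    (q : ℕ) : ContDiff ℝ ∞ fun p : ℝ × ℝ => iteratedDeriv q (H p.1) p.2 := by
  induction q generalizing H with
  | zero => simpa using hH
  | succ q ih =>
    simp_rw [iteratedDeriv_succ']
    refine ih (H := fun s => deriv (H s)) ?_
    have e : (fun p : ℝ × ℝ => deriv (H p.1) p.2) =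
        fun p => fderiv ℝ (fun p : ℝ × ℝ => H p.1 p.2) p (0, 1) :=
      funext fun p => (hasDerivAt_snd hH p.1 p.2).deriv
    rw [e]
    exact contDiff_fderiv_apply_const hH _

open Classical in
/-- The restriction to `K` of a continuous function (zero if the function is not continuous). -/
def restrictTo (K : Set ℝ) (u : ℝ → ℝ) : C(K, ℝ) :=
  if h : Continuous u then ⟨fun t => u t, h.comp continuous_subtype_val⟩ else 0

theorem restrictTo_apply {K : Set ℝ} {u : ℝ → ℝ} (h : Continuous u) (t : K) :
    restrictTo K u t = u t := by
  rw [restrictTo, dif_pos h]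
  rfl

/-- A smooth function of two variables is a smooth curve of continuous functions. -/
theorem contDiff_restrictTo (K : Set ℝ) [CompactSpace K] {H : ℝ → ℝ → ℝ}
    (hH : ContDiff ℝ ∞ fun p : ℝ × ℝ => H p.1 p.2) :
    ContDiff ℝ ∞ fun s => restrictTo K (H s) := by
  have hcont : ∀ {H : ℝ → ℝ → ℝ}, (ContDiff ℝ ∞ fun p : ℝ × ℝ => H p.1 p.2) → ∀ s,
      Continuous (H s) := fun hH s => hH.continuous.comp (Continuous.prodMk_right s)
  refine contDiff_of_deriv_closed
    {c | ∃ H : ℝ → ℝ → ℝ, (ContDiff ℝ ∞ fun p : ℝ × ℝ => H p.1 p.2) ∧ c = fun s => restrictTo K (H s)}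
    ?_ _ ⟨H, hH, rfl⟩
  rintro _ ⟨H, hH, rfl⟩
  set H' : ℝ → ℝ → ℝ := fun s t => fderiv ℝ (fun p : ℝ × ℝ => H p.1 p.2) (s, t) (1, 0) with hH'
  have hH's : ContDiff ℝ ∞ fun p : ℝ × ℝ => H' p.1 p.2 := contDiff_fderiv_apply_const hH _
  refine ⟨_, ⟨H', hH's, rfl⟩, fun s => ?_⟩
  have hc : Continuous fun s => restrictTo K (H' s) := by
    let m : C(ℝ × K, ℝ) := ⟨fun p => H' p.1 p.2, hH's.continuous.comp
      (by fun_prop : Continuous fun p : ℝ × K => (p.1, (p.2 : ℝ)))⟩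
    convert m.curry.continuous using 1
    funext s
    ext t
    exact restrictTo_apply (hcont hH's s) t
  -- Differentiability in the sup norm is read off from this integral formula, which only has to be
  -- checked pointwise.
  have e : (fun s => restrictTo K (H s)) =
      fun s => restrictTo K (H 0) + ∫ x in (0 : ℝ)..s, restrictTo K (H' x) := by
    funext s
    ext t
    have h1 := (ContinuousMap.evalCLM ℝ t).intervalIntegral_comp_comm
      (hc.intervalIntegrable 0 s (μ := MeasureTheory.volume))
    have h2 := intervalIntegral.integral_eq_sub_of_hasDerivAt (a := 0) (b := s)
      (fun x _ => hasDerivAt_fst hH x t)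
      (Continuous.intervalIntegrable (hH's.continuous.comp (by fun_prop : Continuous fun x : ℝ => (x, (t : ℝ)))) _ _)
    rw [ContinuousMap.add_apply]
    change _ = _ + ContinuousMap.evalCLM ℝ t (∫ x in (0 : ℝ)..s, restrictTo K (H' x))
    rw [← h1, restrictTo_apply (hcont hH s), restrictTo_apply (hcont hH 0)]
    have h3 : ∀ x, ContinuousMap.evalCLM ℝ t (restrictTo K (H' x)) = H' x t :=
      fun x => restrictTo_apply (hcont hH's x) t
    simp_rw [h3]
    rw [h2]
    ring
  rw [e]
  exact (hc.integral_hasStrictDerivAt 0 s).hasDerivAt.const_add _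

/-- The fundamental theorem of calculus in the second variable is a linear relation between two
curves of functions; this allows it to be differentiated in the first variable. -/
theorem map_iteratedDeriv_eq {E F : Type*} [NormedAddCommGroup E] [NormedSpace ℝ E]
    [NormedAddCommGroup F] [NormedSpace ℝ F] {c : ℝ → E} {d : ℝ → F} (hc : ContDiff ℝ ∞ c)
    (hd : ContDiff ℝ ∞ d) (L : E →L[ℝ] ℝ) (M : F →L[ℝ] ℝ) (h : ∀ s, L (c s) = M (d s)) (p : ℕ) :
    ∀ s, L (iteratedDeriv p c s) = M (iteratedDeriv p d s) := by
  induction p with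
  | zero => simpa using h
  | succ p ih =>
    intro s
    have h1 := L.hasFDerivAt.comp_hasDerivAt s (hasDerivAt_iteratedDeriv hc p s)
    have h2 := M.hasFDerivAt.comp_hasDerivAt s (hasDerivAt_iteratedDeriv hd p s)
    rw [show L ∘ iteratedDeriv p c = M ∘ iteratedDeriv p d from funext ih] at h1
    exact h1.unique h2

/-- The functional `w ↦ ∫₀ᵗ w`. -/
def integralTo {R : ℝ} (hR : -R ≤ R) (t : ℝ) : C(Set.Icc (-R) R, ℝ) →L[ℝ] ℝ :=
  LinearMap.mkContinuous
    { toFun := fun w => ∫ x in (0 : ℝ)..t, w (Set.projIcc (-R) R hR x)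
      map_add' := fun w w' => by
        refine intervalIntegral.integral_add ?_ ?_ <;>
        exact Continuous.intervalIntegrable ((ContinuousMap.continuous _).comp continuous_projIcc) _ _
      map_smul' := fun r w => intervalIntegral.integral_const_mul _ _ }
    |t| fun w => by
      have := intervalIntegral.norm_integral_le_of_norm_le_const (a := 0) (b := t) (C := ‖w‖)
        (f := fun x => w (Set.projIcc (-R) R hR x)) fun x _ => w.norm_coe_le_norm _
      rw [mul_comm]
      simpa using this

/-- A curve `s ↦ G s` of smooth functions on the line is jointly smooth as soon as all real functions
of it are smooth that are smooth along the jointly smooth curves. -/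
theorem contDiff_of_functionals (G : ℝ → ℝ → ℝ) (hG : ∀ s, ContDiff ℝ ∞ (G s))
    (h : ∀ Λ : (ℝ → ℝ) → ℝ,
      (∀ G₀ : ℝ → ℝ → ℝ, (ContDiff ℝ ∞ fun p : ℝ × ℝ => G₀ p.1 p.2) →
        ContDiff ℝ ∞ fun s => Λ (G₀ s)) → ContDiff ℝ ∞ fun s => Λ (G s)) :
    ContDiff ℝ ∞ fun p : ℝ × ℝ => G p.1 p.2 := by
  rw [contDiff_iff_contDiffAt]
  intro p₀
  set R : ℝ := |p₀.2| + 1 with hRdef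
  have hR0 : 0 < R := by positivity
  have hR : -R ≤ R := by linarith
  set K := Set.Icc (-R) R
  set c : ℕ → ℝ → C(K, ℝ) := fun q s => restrictTo K (iteratedDeriv q (G s)) with hcdef
  have hcq : ∀ q, ContDiff ℝ ∞ (c q) := fun q =>
    -- Since `restrictTo` and `iteratedDeriv` are total, `l` induces a functional on all functions
    -- of the line, as `h` requires.
    contDiff_of_weakly_contDiff _ fun l => h (fun u => l (restrictTo K (iteratedDeriv q u)))
      fun G₀ hG₀ => l.contDiff.comp
        (contDiff_restrictTo K (contDiff_iteratedDeriv_snd hG₀ q))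
  have hca : ∀ q s (t : K), c q s t = iteratedDeriv q (G s) t := fun q s t =>
    restrictTo_apply (contDiff_iteratedDeriv (hG s) q).continuous t
  have hK0 : (0 : ℝ) ∈ K := ⟨by linarith, hR0.le⟩
  -- `F p q` plays the role of `∂ₛᵖ ∂ₜ^q G` on `ℝ × K`, the projection onto `K` only making it
  -- total. The family is closed under `∂ₛ` by construction and under `∂ₜ` by `hrel`.
  let F : ℕ → ℕ → ℝ → ℝ → ℝ := fun p q s t => iteratedDeriv p (c q) s (Set.projIcc (-R) R hR t)
  have hrel : ∀ p q s (t : K), iteratedDeriv p (c q) s t =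
      iteratedDeriv p (c q) s ⟨0, hK0⟩ + ∫ x in (0 : ℝ)..t, F p (q + 1) s x := by
    intro p q s t
    have := map_iteratedDeriv_eq (hcq q) (hcq (q + 1))
      (ContinuousMap.evalCLM ℝ t - ContinuousMap.evalCLM ℝ ⟨0, hK0⟩) (integralTo hR t) (fun s => by
        change c q s t - c q s ⟨0, hK0⟩ = ∫ x in (0 : ℝ)..t, c (q + 1) s (Set.projIcc (-R) R hR x)
        rw [hca, hca]
        rw [← intervalIntegral.integral_eq_sub_of_hasDerivAt
          (fun x _ => hasDerivAt_iteratedDeriv (hG s) q x)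
          ((contDiff_iteratedDeriv (hG s) (q + 1)).continuous.intervalIntegrable _ _)]
        refine intervalIntegral.integral_congr fun x hx => ?_
        have hxK : x ∈ K := Set.uIcc_subset_Icc hK0 t.2 hx
        rw [hca, Set.projIcc_of_mem hR hxK]) p s
    exact eq_add_of_sub_eq' this
  set U : Set (ℝ × ℝ) := Set.univ ×ˢ Set.Ioo (-R) R
  have hU : IsOpen U := isOpen_univ.prod isOpen_Ioo
  have hFc : ∀ p q, Continuous fun x : ℝ × ℝ => F p q x.1 x.2 := fun p q => by
    have h1 := (contDiff_iteratedDeriv (hcq q) p).continuous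
    exact (h1.comp continuous_fst).eval (continuous_projIcc.comp continuous_snd)
  have main := contDiffOn_of_partials_closed hU {f | ∃ p q, f = F p q} (by
      rintro _ ⟨p, q, rfl⟩
      exact (hFc p q).continuousOn) (by
      rintro _ ⟨p, q, rfl⟩
      refine ⟨_, ⟨p + 1, q, rfl⟩, _, ⟨p, q + 1, rfl⟩, fun x hx => ⟨?_, ?_⟩⟩
      · exact (ContinuousMap.evalCLM ℝ (Set.projIcc (-R) R hR x.2)).hasFDerivAt.comp_hasDerivAt x.1
          (hasDerivAt_iteratedDeriv (hcq q) p x.1)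
      · have hF : Continuous (F p (q + 1) x.1) := (hFc p (q + 1)).comp (Continuous.prodMk_right x.1)
        have h1 := ((hF.integral_hasStrictDerivAt 0 x.2).hasDerivAt.const_add
          (iteratedDeriv p (c q) x.1 ⟨0, hK0⟩))
        refine h1.congr_of_eventuallyEq ?_
        filter_upwards [isOpen_Ioo.mem_nhds hx.2] with t ht
        change iteratedDeriv p (c q) x.1 (Set.projIcc (-R) R hR t) = _
        rw [Set.projIcc_of_mem hR ⟨ht.1.le, ht.2.le⟩, hrel]) (F 0 0) ⟨0, 0, rfl⟩
  have hp₀ : p₀ ∈ U := ⟨trivial, abs_lt.1 (by rw [hRdef]; linarith)⟩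
  refine (main.contDiffAt (hU.mem_nhds hp₀)).congr_of_eventuallyEq ?_
  filter_upwards [hU.mem_nhds hp₀] with x hx
  change _ = iteratedDeriv 0 (c 0) x.1 (Set.projIcc (-R) R hR x.2)
  rw [Set.projIcc_of_mem hR ⟨hx.2.1.le, hx.2.2.le⟩, iteratedDeriv_zero, hca, iteratedDeriv_zero]

/-! ### Boman's theorem in the plane -/

/-- Take `ε n = 2⁻ⁿ / M n`, where `M n` bounds the derivatives of `φ n` up to order `n`. For each
`k`, the `k`-th derivatives are then dominated by a geometric series from `n = k` on. -/
theorem exists_coeff_contDiff_tsum (φ : ℕ → ℝ → ℝ) (hφ : ∀ n, ContDiff ℝ ∞ (φ n))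
    (hs : ∀ n, HasCompactSupport (φ n)) :
    ∃ ε : ℕ → ℝ, (∀ n, 0 < ε n) ∧
      ∀ a : ℕ → ℝ, (∀ n, |a n| ≤ ε n) → ContDiff ℝ ∞ fun t => ∑' n, a n * φ n t := by
  have hM : ∀ n, ∃ M : ℝ, 0 < M ∧ ∀ k ≤ n, ∀ x, ‖iteratedFDeriv ℝ k (φ n) x‖ ≤ M := by
    intro n
    have h1 : ∀ k, ∃ C, ∀ x, ‖iteratedFDeriv ℝ k (φ n) x‖ ≤ C := fun k =>
      ((hφ n).continuous_iteratedFDeriv (m := k) (by exact_mod_cast le_top)).bounded_above_of_compact_support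
        ((hs n).iteratedFDeriv k)
    choose C hC using h1
    refine ⟨∑ k ∈ Finset.range (n + 1), |C k| + 1, by positivity, fun k hk x => ?_⟩
    have h2 := Finset.single_le_sum (f := fun k => |C k|) (fun i _ => abs_nonneg _)
      (Finset.mem_range.2 (Nat.lt_succ_of_le hk))
    have := hC k x
    have := le_abs_self (C k)
    linarith
  choose M hM0 hM using hM
  refine ⟨fun n => (1 / 2) ^ n / M n, fun n => div_pos (by positivity) (hM0 n), fun a ha => ?_⟩
  refine contDiff_tsum_of_eventually (N := ⊤) (v := fun _ n => (1 / 2 : ℝ) ^ n)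
    (fun n => contDiff_const.mul (hφ n)) (fun _ _ => summable_geometric_two) fun k _ => ?_
  rw [Nat.cofinite_eq_atTop]
  filter_upwards [eventually_ge_atTop k] with n hn x
  have e : iteratedFDeriv ℝ k (fun t => a n * φ n t) x = a n • iteratedFDeriv ℝ k (φ n) x :=
    iteratedFDeriv_const_smul_apply' (a := a n)
      (((hφ n).of_le (by exact_mod_cast le_top : (k : WithTop ℕ∞) ≤ ∞)).contDiffAt)
  rw [e, norm_smul]
  calc ‖a n‖ * ‖iteratedFDeriv ℝ k (φ n) x‖ ≤ ((1 / 2) ^ n / M n) * M n :=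
        mul_le_mul (ha n) (hM n k hn x) (norm_nonneg _) (div_pos (by positivity) (hM0 n)).le
    _ = (1 / 2) ^ n := div_mul_cancel₀ _ (hM0 n).ne'

/-- The special curve lemma: sufficiently small affine pieces at the points `2⁻ⁿ` can be
interpolated by a smooth function. -/
theorem exists_special_curve :
    ∃ ε : ℕ → ℝ, (∀ n, 0 < ε n) ∧ ∀ a b : ℕ → ℝ, (∀ n, |a n| ≤ ε n) → (∀ n, |b n| ≤ ε n) →
      ∃ γ : ℝ → ℝ, ContDiff ℝ ∞ γ ∧
        ∀ n : ℕ, ∀ᶠ t in 𝓝 ((1 / 2 : ℝ) ^ n), γ t = a n + b n * (t - (1 / 2) ^ n) := by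
  let τ : ℕ → ℝ := fun n => (1 / 2) ^ n
  have hτ : ∀ n, 0 < τ n := fun n => by positivity
  -- The points nearest to `τ n` are at distance at least `τ n / 2`; with these radii every other
  -- bump vanishes where the `n`-th one is `1` by construction.
  let χ : ∀ n, ContDiffBump (τ n) := fun n =>
    ⟨τ n / 8, τ n / 4, by have := hτ n; positivity, by have := hτ n; linarith⟩
  have hχ : ∀ n, ContDiff ℝ ∞ (χ n) := fun n => (χ n).contDiff
  obtain ⟨ε₁, h₁, H₁⟩ := exists_coeff_contDiff_tsum (fun n => χ n) hχ fun n => (χ n).hasCompactSupport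
  obtain ⟨ε₂, h₂, H₂⟩ := exists_coeff_contDiff_tsum (fun n t => χ n t * (t - τ n))
    (fun n => (hχ n).mul (contDiff_id.sub contDiff_const))
    fun n => (χ n).hasCompactSupport.mul_right
  refine ⟨fun n => min (ε₁ n) (ε₂ n), fun n => lt_min (h₁ n) (h₂ n), fun a b ha hb => ?_⟩
  refine ⟨_, (H₁ a fun n => (ha n).trans (min_le_left _ _)).add
    (H₂ b fun n => (hb n).trans (min_le_right _ _)), fun n => ?_⟩
  filter_upwards [Metric.ball_mem_nhds _ (show 0 < τ n / 8 by have := hτ n; positivity)] with t ht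
  have ht' : |t - τ n| < τ n / 8 := ht
  have h1 : χ n t = 1 := (χ n).one_of_mem_closedBall ht'.le
  have h0 : ∀ m, m ≠ n → χ m t = 0 := by
    intro m hm
    apply (χ m).zero_of_le_dist
    change τ m / 4 ≤ |t - τ m|
    rw [abs_lt] at ht'
    have hmul : ∀ i j, i < j → τ j ≤ τ i / 2 := by
      intro i j hij
      have : τ j ≤ τ (i + 1) := pow_le_pow_of_le_one (by norm_num) (by norm_num) hij
      have h2 : τ (i + 1) = τ i / 2 := by simp only [τ, pow_succ]; ring
      linarith
    have := hτ n
    have := hτ m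
    rcases lt_or_gt_of_ne hm with h | h
    · have := hmul _ _ h
      rw [le_abs]; right; linarith
    · have := hmul _ _ h
      rw [le_abs]; left; linarith
  rw [tsum_eq_single n fun m hm => by rw [h0 m hm, mul_zero],
    tsum_eq_single n fun m hm => by rw [h0 m hm, zero_mul, mul_zero], h1, mul_one, one_mul]

/-- A function of two variables that is smooth along all smooth curves. -/
def SmoothAlongCurves (K : ℝ → ℝ → ℝ) : Prop :=
  ∀ a b : ℝ → ℝ, ContDiff ℝ ∞ a → ContDiff ℝ ∞ b → ContDiff ℝ ∞ fun r => K (a r) (b r)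

theorem SmoothAlongCurves.comp {K : ℝ → ℝ → ℝ} (hK : SmoothAlongCurves K) {f g : ℝ → ℝ → ℝ}
    (hf : ContDiff ℝ ∞ fun p : ℝ × ℝ => f p.1 p.2) (hg : ContDiff ℝ ∞ fun p : ℝ × ℝ => g p.1 p.2) :
    SmoothAlongCurves fun s t => K (f s t) (g s t) := fun _ _ ha hb =>
  hK _ _ (hf.comp (ha.prodMk hb)) (hg.comp (ha.prodMk hb))

theorem SmoothAlongCurves.contDiff_snd {K : ℝ → ℝ → ℝ} (hK : SmoothAlongCurves K) (s : ℝ) :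
    ContDiff ℝ ∞ (K s) := hK _ _ contDiff_const contDiff_id

/-- Otherwise a special curve runs through points `(t n, e n)` converging fast to `(t₀, e₀)` along
which the derivative blows up. Composing `K` with it gives a smooth function of one variable whose
`p`-th derivative is unbounded on `[0, 1]`. -/
theorem SmoothAlongCurves.exists_bound {K : ℝ → ℝ → ℝ} (hK : SmoothAlongCurves K) (p : ℕ)
    (t₀ e₀ : ℝ) : ∃ C r : ℝ, 0 < r ∧ ∀ t e, |t - t₀| < r → |e - e₀| < r →
      |iteratedDeriv p (K t) e| ≤ C := by
  by_contra! hcon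
  obtain ⟨ε, hε, H⟩ := exists_special_curve
  -- Near `2⁻ⁿ` the first component is constant and the second has slope `ε n`, so the chain rule
  -- multiplies the `p`-th derivative by `ε n ^ p`; the threshold compensates for this factor.
  choose t e ht he hbig using fun n : ℕ => hcon (n / ε n ^ p) (ε n) (hε n)
  obtain ⟨γ₁, hγ₁, h₁⟩ := H (fun n => t n - t₀) 0 (fun n => (ht n).le)
    (fun n => by simpa using (hε n).le)
  obtain ⟨γ₂, hγ₂, h₂⟩ := H (fun n => e n - e₀) ε (fun n => (he n).le)
    (fun n => (abs_of_pos (hε n)).le)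
  have hF := hK (fun r => t₀ + γ₁ r) (fun r => e₀ + γ₂ r) (contDiff_const.add hγ₁)
    (contDiff_const.add hγ₂)
  obtain ⟨C, hC⟩ := (isCompact_Icc (a := (0 : ℝ)) (b := 1)).exists_bound_of_continuousOn
    (contDiff_iteratedDeriv hF p).continuous.continuousOn
  obtain ⟨n, hn⟩ := exists_nat_gt C
  have hτ : (1 / 2 : ℝ) ^ n ∈ Set.Icc (0 : ℝ) 1 :=
    ⟨by positivity, pow_le_one₀ (by norm_num) (by norm_num)⟩
  have h3 := hC _ hτ
  have e1 : iteratedDeriv p (fun r => K (t₀ + γ₁ r) (e₀ + γ₂ r)) ((1 / 2) ^ n) =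
      ε n ^ p * iteratedDeriv p (K (t n)) (e n) := by
    have e2 : (fun r => K (t₀ + γ₁ r) (e₀ + γ₂ r)) =ᶠ[𝓝 ((1 / 2) ^ n)]
        fun r => (fun x => K (t n) (x + (e n - ε n * (1 / 2) ^ n))) (ε n * r) := by
      filter_upwards [h₁ n, h₂ n] with r hr₁ hr₂
      simp only [hr₁, hr₂, Pi.zero_apply]
      congr 1 <;> ring
    have e3 := iteratedDeriv_comp_const_mul (n := p)
      (f := fun x => K (t n) (x + (e n - ε n * (1 / 2) ^ n)))
      (((hK.contDiff_snd (t n)).comp (contDiff_id.add contDiff_const)).of_le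
        (by exact_mod_cast le_top)) (ε n)
    rw [e2.iteratedDeriv_eq]
    refine (congrFun e3 _).trans ?_
    rw [iteratedDeriv_comp_add_const]
    exact congrArg (fun x => ε n ^ p * iteratedDeriv p (K (t n)) x) (add_sub_cancel _ _)
  rw [e1, norm_mul, Real.norm_eq_abs, Real.norm_eq_abs, abs_of_pos (pow_pos (hε n) p)] at h3
  have h4 := hbig n
  rw [div_lt_iff₀ (pow_pos (hε n) p), mul_comm] at h4
  linarith

/-- The remainder of `m` has as derivative the remainder of `m'`, so the mean value inequality gives
the induction. The factor `1 / n!` is dropped, since only the order in `x` and uniformity in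
parameters matter later. -/
theorem taylor_bound (n : ℕ) : ∀ (m : ℝ → ℝ), ContDiff ℝ ∞ m → ∀ C r : ℝ,
    (∀ x, |x| < r → |iteratedDeriv n m x| ≤ C) → ∀ x, |x| < r →
      |m x - ∑ i ∈ Finset.range n, iteratedDeriv i m 0 / i.factorial * x ^ i| ≤ C * |x| ^ n := by
  induction n with
  | zero => intro m _ C r hC x hx; simpa using hC x hx
  | succ n ih =>
    intro m hm C r hC x hx
    have hm' : ContDiff ℝ ∞ (deriv m) := hm.iterate_deriv 1
    have IH := ih (deriv m) hm' C r (fun x hx => by rw [← iteratedDeriv_succ']; exact hC x hx)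
    have hd : ∀ y, HasDerivAt
        (fun x => m x - ∑ i ∈ Finset.range (n + 1), iteratedDeriv i m 0 / i.factorial * x ^ i)
        (deriv m y - ∑ i ∈ Finset.range n, iteratedDeriv i (deriv m) 0 / i.factorial * y ^ i) y := by
      intro y
      refine (hm.differentiable (by simp) y).hasDerivAt.sub ?_
      simp_rw [Finset.sum_range_succ' _ n]
      simp only [pow_zero, mul_one]
      refine HasDerivAt.add_const _ ?_
      refine HasDerivAt.fun_sum fun i _ => ?_
      have e : iteratedDeriv i (deriv m) 0 / i.factorial * y ^ i =
          iteratedDeriv (i + 1) m 0 / (i + 1).factorial * (((i + 1 : ℕ) : ℝ) * y ^ (i + 1 - 1)) := by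
        rw [iteratedDeriv_succ', Nat.factorial_succ]
        push_cast
        have : (i.factorial : ℝ) ≠ 0 := by positivity
        field_simp
      rw [e]
      exact (hasDerivAt_pow (i + 1) y).const_mul (iteratedDeriv (i + 1) m 0 / (i + 1).factorial)
    have h0 : |x| < r → ∀ y ∈ Set.uIcc 0 x, |y| ≤ |x| := fun _ y hy => by
      rcases Set.mem_uIcc.1 hy with h | h
      · rw [abs_of_nonneg h.1, abs_of_nonneg (h.1.trans h.2)]; exact h.2
      · rw [abs_of_nonpos h.2, abs_of_nonpos (h.1.trans h.2)]; linarith [h.1]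
    have hC0 : 0 ≤ C := (abs_nonneg _).trans (hC x hx)
    have := (convex_uIcc 0 x).norm_image_sub_le_of_norm_hasDerivWithin_le
      (C := C * |x| ^ n) (fun y _ => (hd y).hasDerivWithinAt) (fun y hy => by
        refine (IH y ((h0 hx y hy).trans_lt hx)).trans ?_
        exact mul_le_mul_of_nonneg_left (pow_le_pow_left₀ (abs_nonneg _) (h0 hx y hy) n) hC0)
      Set.left_mem_uIcc Set.right_mem_uIcc
    simp only [Finset.sum_range_succ' _ n, pow_zero, mul_one] at this ⊢
    simpa [pow_succ, mul_assoc] using this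

open Polynomial Asymptotics in
theorem X_pow_dvd_of_isBigO (P : ℝ[X]) (p : ℕ)
    (h : (fun x => P.eval x) =O[𝓝[≠] (0 : ℝ)] fun x => x ^ p) : X ^ p ∣ P := by
  induction p with
  | zero => simp
  | succ p ih =>
    obtain ⟨Q, rfl⟩ := ih (h.trans (IsBigO.of_bound 1 (by
      filter_upwards [mem_nhdsWithin_of_mem_nhds (Metric.ball_mem_nhds (0 : ℝ) one_pos)] with x hx
      rw [pow_succ, norm_mul, one_mul]
      exact mul_le_of_le_one_right (norm_nonneg _) ((mem_ball_zero_iff.1 hx).le))))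
    have h1 : (fun x => Q.eval x) =O[𝓝[≠] (0 : ℝ)] fun x => x := by
      obtain ⟨C, hC⟩ := h.bound
      refine IsBigO.of_bound C ?_
      filter_upwards [hC, self_mem_nhdsWithin] with x hx h0
      rw [eval_mul, eval_pow, eval_X, pow_succ, norm_mul, norm_mul, mul_left_comm] at hx
      exact le_of_mul_le_mul_left hx (norm_pos_iff.2 (pow_ne_zero p h0))
    have h2 : Tendsto (fun x => Q.eval x) (𝓝[≠] (0 : ℝ)) (𝓝 0) :=
      h1.trans_tendsto (tendsto_id.mono_left nhdsWithin_le_nhds)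
    have h3 : Tendsto (fun x => Q.eval x) (𝓝[≠] (0 : ℝ)) (𝓝 (Q.eval 0)) :=
      (Q.continuous.tendsto 0).mono_left nhdsWithin_le_nhds
    have h4 : X ∣ Q := by
      rw [X_dvd_iff, coeff_zero_eq_eval_zero]
      exact tendsto_nhds_unique h3 h2
    rw [pow_succ]
    exact mul_dvd_mul_left _ h4

-- Since `k` is bounded near `t`, `P` is `O(xᵖ)` and so equals `xᵖ Q`. Dividing by `xᵖ` leaves `Q x
-- - k (t + x) = O(x²)`, whence `k` has the derivative `Q' 0` at `t`.
open Polynomial Asymptotics in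
theorem hasDerivAt_of_polynomial_approx {k : ℝ → ℝ} {t : ℝ} (hk : ContinuousAt k t) (P : ℝ[X])
    (p : ℕ) (h : (fun x => P.eval x - x ^ p * k (t + x)) =O[𝓝 0] fun x => x ^ (p + 2)) :
    HasDerivAt k (P.coeff (p + 1)) t := by
  have hk' : Tendsto (fun x => k (t + x)) (𝓝 0) (𝓝 (k t)) := by
    have : Tendsto (fun x => t + x) (𝓝 0) (𝓝 t) := by
      simpa using (continuous_const_add t).tendsto 0
    exact hk.tendsto.comp this
  have h1 : (fun x => x ^ p * k (t + x)) =O[𝓝 0] fun x => x ^ p := by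
    simpa using (isBigO_refl (fun x : ℝ => x ^ p) (𝓝 0)).mul (hk'.isBigO_one ℝ)
  have h2 : (fun x : ℝ => x ^ (p + 2)) =O[𝓝 0] fun x => x ^ p := by
    have := (isBigO_refl (fun x : ℝ => x ^ p) (𝓝 0)).mul
      (((continuous_pow 2).tendsto (0 : ℝ)).isBigO_one ℝ)
    simpa [pow_add] using this
  have h3 : (fun x => P.eval x) =O[𝓝 0] fun x => x ^ p := by
    simpa using (h.trans h2).add h1
  obtain ⟨Q, rfl⟩ := X_pow_dvd_of_isBigO P p (h3.mono nhdsWithin_le_nhds)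
  have h4 : (fun x => Q.eval x - k (t + x)) =O[𝓝[≠] 0] fun x => x ^ 2 := by
    obtain ⟨C, hC⟩ := h.bound
    refine IsBigO.of_bound C ?_
    filter_upwards [mem_nhdsWithin_of_mem_nhds hC, self_mem_nhdsWithin] with x hx h0
    rw [eval_mul, eval_pow, eval_X, ← mul_sub, pow_add, norm_mul, norm_mul, mul_left_comm] at hx
    exact le_of_mul_le_mul_left hx (norm_pos_iff.2 (pow_ne_zero p h0))
  have hQ0 : Q.eval 0 = k t := by
    have h5 : Tendsto (fun x => Q.eval x - k (t + x)) (𝓝[≠] 0) (𝓝 (Q.eval 0 - k t)) :=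
      ((Q.continuous.tendsto 0).sub hk').mono_left nhdsWithin_le_nhds
    have h6 : Tendsto (fun x => Q.eval x - k (t + x)) (𝓝[≠] 0) (𝓝 0) := by
      refine h4.trans_tendsto ?_
      have := ((continuous_pow 2).tendsto (0 : ℝ)).mono_left (nhdsWithin_le_nhds (s := {0}ᶜ))
      simpa using this
    exact sub_eq_zero.1 (tendsto_nhds_unique h5 h6)
  have h7 : HasDerivAt (fun x => Q.eval x - k (t + x)) 0 0 := by
    rw [hasDerivAt_iff_tendsto_slope_zero]
    have : (fun x : ℝ => x⁻¹ • (Q.eval (0 + x) - k (t + (0 + x)) - (Q.eval 0 - k (t + 0)))) =O[𝓝[≠] 0]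
        fun x => x := by
      obtain ⟨C, hC⟩ := h4.bound
      refine IsBigO.of_bound C ?_
      filter_upwards [hC, self_mem_nhdsWithin] with x hx h0
      have hpos : 0 < ‖x‖ := norm_pos_iff.2 h0
      rw [zero_add, add_zero, hQ0, sub_self, sub_zero, norm_smul, norm_inv, inv_mul_le_iff₀ hpos]
      rw [norm_pow] at hx
      linarith
    exact this.trans_tendsto (tendsto_id.mono_left nhdsWithin_le_nhds)
  have h8 : HasDerivAt (fun x => k (t + x)) (Q.coeff 1) 0 := by
    have h9 := (Q.hasDerivAt 0).sub h7
    have e : (Q.eval · : ℝ → ℝ) - (fun x => Q.eval x - k (t + x)) = fun x => k (t + x) := by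
      funext x; simp
    rw [sub_zero] at h9
    have e2 : (derivative Q).eval 0 = Q.coeff 1 := by
      rw [← coeff_zero_eq_eval_zero, coeff_derivative]; simp
    rw [e2] at h9
    refine h9.congr_of_eventuallyEq (Eventually.of_forall fun x => ?_)
    exact (congrFun e x).symm
  have h10 : (X ^ p * Q).coeff (p + 1) = Q.coeff 1 := by
    rw [add_comm, coeff_X_pow_mul]
  rw [h10]
  have h11 := HasDerivAt.comp_sub_const (f := fun x => k (t + x)) t t (by rwa [sub_self])
  simpa using h11

/-- Weights of a finite difference for the `p`-th derivative. The `p + 2` nodes `0, …, p + 1` are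
one more than needed, so that the term of order `p + 1` cancels too and the error has order `p + 2`.
-/
theorem exists_vandermonde_coeff (p : ℕ) : ∃ c : Fin (p + 2) → ℝ, ∀ i < p + 2,
    ∑ j, c j * ((j : ℕ) : ℝ) ^ i = if i = p then (p.factorial : ℝ) else 0 := by
  let V : Matrix (Fin (p + 2)) (Fin (p + 2)) ℝ := Matrix.vandermonde fun j => ((j : ℕ) : ℝ)
  have hV : IsUnit V.det := by
    rw [isUnit_iff_ne_zero]
    exact Matrix.det_vandermonde_ne_zero_iff.2 fun i j h => Fin.ext (by exact_mod_cast h)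
  let e : Fin (p + 2) → ℝ := fun i => if (i : ℕ) = p then (p.factorial : ℝ) else 0
  refine ⟨Matrix.vecMul e V⁻¹, fun i hi => ?_⟩
  have : Matrix.vecMul (Matrix.vecMul e V⁻¹) V = e := by
    rw [Matrix.vecMul_vecMul, Matrix.nonsing_inv_mul _ hV, Matrix.vecMul_one]
  exact congrFun this ⟨i, hi⟩

theorem SmoothAlongCurves.sum {ι : Type*} [Fintype ι] {c : ι → ℝ} {K : ι → ℝ → ℝ → ℝ}
    (hK : ∀ j, SmoothAlongCurves (K j)) : SmoothAlongCurves fun s t => ∑ j, c j * K j s t :=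
  fun a b ha hb => ContDiff.sum fun j _ => contDiff_const.mul (hK j a b ha hb)

/-- The weights applied to Taylor expansions at the nodes leave only the `p`-th term; the remainders
are uniform in `t` near `t₀` by `exists_bound`. -/
theorem SmoothAlongCurves.finite_difference {K : ℝ → ℝ → ℝ} (hK : SmoothAlongCurves K) (p : ℕ)
    {c : Fin (p + 2) → ℝ} (hc : ∀ i < p + 2,
      ∑ j, c j * ((j : ℕ) : ℝ) ^ i = if i = p then (p.factorial : ℝ) else 0) (t₀ : ℝ) :
    ∃ C r : ℝ, 0 < r ∧ ∀ t δ, |t - t₀| < r → |δ| < r →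
      |∑ j, c j * K t ((j : ℕ) * δ) - δ ^ p * iteratedDeriv p (K t) 0| ≤ C * |δ| ^ (p + 2) := by
  obtain ⟨C, r, hr, hb⟩ := hK.exists_bound (p + 2) t₀ 0
  have hC : 0 ≤ C := (abs_nonneg _).trans (hb t₀ 0 (by simpa using hr) (by simpa using hr))
  have hp : (0 : ℝ) < p + 2 := by positivity
  -- Shrinking the radius by `p + 2` keeps all nodes `j * δ` within `r`.
  refine ⟨∑ j, |c j| * (C * ((p : ℝ) + 2) ^ (p + 2)), r / (p + 2), by positivity,
    fun t δ ht hδ => ?_⟩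
  have hr' : r / (p + 2) ≤ r := div_le_self hr.le (by linarith [(Nat.cast_nonneg p : (0 : ℝ) ≤ p)])
  have hj : ∀ j : Fin (p + 2), ((j : ℕ) : ℝ) ≤ p + 2 := fun j => by
    have := j.2.le; exact_mod_cast this
  have hT : ∀ j : Fin (p + 2), |K t ((j : ℕ) * δ) - ∑ i ∈ Finset.range (p + 2),
      iteratedDeriv i (K t) 0 / i.factorial * ((j : ℕ) * δ) ^ i| ≤
        C * ((p : ℝ) + 2) ^ (p + 2) * |δ| ^ (p + 2) := by
    intro j
    have h1 : |((j : ℕ) : ℝ) * δ| ≤ (p + 2) * |δ| := by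
      rw [abs_mul, Nat.abs_cast]
      exact mul_le_mul_of_nonneg_right (hj j) (abs_nonneg _)
    have h2 : |((j : ℕ) : ℝ) * δ| < r := by
      rw [lt_div_iff₀ hp] at hδ
      linarith
    refine (taylor_bound (p + 2) (K t) (hK.contDiff_snd t) C r
      (fun x hx => hb t x (ht.trans_le hr') (by simpa using hx)) _ h2).trans ?_
    rw [mul_assoc, ← mul_pow]
    exact mul_le_mul_of_nonneg_left (pow_le_pow_left₀ (abs_nonneg _) h1 _) hC
  have e : δ ^ p * iteratedDeriv p (K t) 0 = ∑ j, c j * ∑ i ∈ Finset.range (p + 2),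
      iteratedDeriv i (K t) 0 / i.factorial * ((j : ℕ) * δ) ^ i := by
    simp_rw [Finset.mul_sum]
    rw [Finset.sum_comm]
    have : ∀ i ∈ Finset.range (p + 2), ∑ j : Fin (p + 2),
        c j * (iteratedDeriv i (K t) 0 / i.factorial * (((j : ℕ) : ℝ) * δ) ^ i) =
        if i = p then δ ^ p * iteratedDeriv p (K t) 0 else 0 := by
      intro i hi
      have h1 := hc i (Finset.mem_range.1 hi)
      have h2 : ∑ j : Fin (p + 2),
          c j * (iteratedDeriv i (K t) 0 / i.factorial * (((j : ℕ) : ℝ) * δ) ^ i) =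
          iteratedDeriv i (K t) 0 / i.factorial * δ ^ i * ∑ j, c j * ((j : ℕ) : ℝ) ^ i := by
        rw [Finset.mul_sum]
        exact Finset.sum_congr rfl fun j _ => by rw [mul_pow]; ring
      rw [h2, h1]
      split_ifs with h
      · subst h
        have : (i.factorial : ℝ) ≠ 0 := by positivity
        field_simp
      · rw [mul_zero]
    rw [Finset.sum_congr rfl this, Finset.sum_ite_eq' _ _ _, if_pos (Finset.mem_range.2 (by omega))]
  rw [e, ← Finset.sum_sub_distrib, Finset.sum_mul]
  refine (Finset.abs_sum_le_sum_abs _ _).trans (Finset.sum_le_sum fun j _ => ?_)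
  rw [← mul_sub, abs_mul, mul_assoc]
  exact mul_le_mul_of_nonneg_left (hT j) (abs_nonneg _)

theorem SmoothAlongCurves.contDiff_fst {K : ℝ → ℝ → ℝ} (hK : SmoothAlongCurves K) (t : ℝ) :
    ContDiff ℝ ∞ fun s => K s t := hK _ _ contDiff_id contDiff_const

/-- The derivative is a locally uniform limit, with error `C * δ ^ 2`, of finite differences that
are continuous in `t`. -/
theorem SmoothAlongCurves.continuous_iteratedDeriv {K : ℝ → ℝ → ℝ} (hK : SmoothAlongCurves K)
    (p : ℕ) : Continuous fun t => iteratedDeriv p (K t) 0 := by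
  obtain ⟨c, hc⟩ := exists_vandermonde_coeff p
  refine continuous_of_locally_uniform_approx_of_continuousAt fun t₀ u hu => ?_
  obtain ⟨η, hη, hu⟩ := Metric.mem_uniformity_dist.1 hu
  obtain ⟨C, r, hr, h⟩ := hK.finite_difference p hc t₀
  obtain ⟨δ, hδ0, hδ⟩ : ∃ δ : ℝ, 0 < δ ∧ δ < r ∧ C * δ ^ 2 < η := by
    have h1 : Tendsto (fun δ : ℝ => C * δ ^ 2) (𝓝[>] 0) (𝓝 0) := by
      have : Continuous fun δ : ℝ => C * δ ^ 2 := by fun_prop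
      simpa using (this.tendsto 0).mono_left nhdsWithin_le_nhds
    have h2 : ∀ᶠ δ in 𝓝[>] (0 : ℝ), δ ∈ Set.Ioo 0 r := Ioo_mem_nhdsGT hr
    obtain ⟨δ, h3, h4⟩ := (h2.and (h1.eventually_lt_const hη)).exists
    exact ⟨δ, h3.1, h3.2, h4⟩
  refine ⟨Metric.ball t₀ r, Metric.ball_mem_nhds _ hr,
    fun t => (∑ j, c j * K t ((j : ℕ) * δ)) / δ ^ p, ?_, fun t ht => hu ?_⟩
  · refine Continuous.continuousAt (Continuous.div_const (continuous_finsetSum _ fun j _ => ?_) _)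
    exact continuous_const.mul (hK.contDiff_fst _).continuous
  · have h1 := h t δ ht (by rw [abs_of_pos hδ0]; exact hδ.1)
    have hp := pow_pos hδ0 p
    rw [Real.dist_eq, abs_sub_comm]
    have e : (∑ j, c j * K t ((j : ℕ) * δ)) / δ ^ p - iteratedDeriv p (K t) 0 =
        (∑ j, c j * K t ((j : ℕ) * δ) - δ ^ p * iteratedDeriv p (K t) 0) / δ ^ p := by
      rw [sub_div, mul_div_cancel_left₀ _ hp.ne']
    rw [e, abs_div, abs_of_pos hp, div_lt_iff₀ hp]
    refine h1.trans_lt ?_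
    rw [abs_of_pos hδ0, pow_add, mul_left_comm, mul_comm]
    exact mul_lt_mul_of_pos_right hδ.2 hp

-- Write `k t` for the `p`-th derivative at `0`, and let `L (t, x)` be the finite difference with
-- step `x` based at `t + x`. Then `L (t, x) = xᵖ k (t + x) + O(x^(p+2))`, while Taylor's formula
-- expands `L (t, ·)` in powers of `x`. Comparing the two differentiates `k`, and the derivative is
-- again of the same form, with a multiple of `L` for `K`.
open Polynomial Asymptotics in
theorem SmoothAlongCurves.exists_hasDerivAt_iteratedDeriv {K : ℝ → ℝ → ℝ}
    (hK : SmoothAlongCurves K) (p : ℕ) : ∃ L, SmoothAlongCurves L ∧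
      ∀ t, HasDerivAt (fun t => iteratedDeriv p (K t) 0) (iteratedDeriv (p + 1) (L t) 0) t := by
  obtain ⟨c, hc⟩ := exists_vandermonde_coeff p
  let L : ℝ → ℝ → ℝ := fun s e => ∑ j : Fin (p + 2), c j * K (s + e) ((j : ℕ) * e)
  have hL : SmoothAlongCurves L := SmoothAlongCurves.sum fun j => hK.comp
    (by fun_prop : ContDiff ℝ ∞ fun p : ℝ × ℝ => p.1 + p.2) (g := fun _ e => (j : ℕ) * e) (by fun_prop)
  refine ⟨fun s e => ((p + 1).factorial : ℝ)⁻¹ * L s e,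
    fun a b ha hb => contDiff_const.mul (hL a b ha hb), fun t => ?_⟩
  simp_rw [iteratedDeriv_const_mul_field]
  let P : ℝ[X] := ∑ i ∈ Finset.range (p + 2), C (iteratedDeriv i (L t) 0 / i.factorial) * X ^ i
  have hP : P.coeff (p + 1) = ((p + 1).factorial : ℝ)⁻¹ * iteratedDeriv (p + 1) (L t) 0 := by
    simp only [P, finsetSum_coeff, coeff_C_mul_X_pow]
    rw [Finset.sum_ite_eq, if_pos (Finset.mem_range.2 (by omega)), div_eq_inv_mul]
  rw [← hP]
  refine hasDerivAt_of_polynomial_approx (hK.continuous_iteratedDeriv p).continuousAt P p ?_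
  obtain ⟨C₁, r₁, hr₁, h₁⟩ := hK.finite_difference p hc t
  obtain ⟨C₂, r₂, hr₂, h₂⟩ := hL.exists_bound (p + 2) t 0
  refine IsBigO.of_bound (C₁ + C₂) ?_
  filter_upwards [Metric.ball_mem_nhds (0 : ℝ) hr₁, Metric.ball_mem_nhds (0 : ℝ) hr₂] with x hx₁ hx₂
  rw [mem_ball_zero_iff] at hx₁ hx₂
  have h3 := h₁ (t + x) x (by simpa using hx₁) hx₁
  have h4 := taylor_bound (p + 2) (L t) (hL.contDiff_snd t) C₂ r₂
    (fun y hy => h₂ t y (by simpa using hr₂) (by simpa using hy)) x hx₂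
  have h5 : P.eval x = ∑ i ∈ Finset.range (p + 2), iteratedDeriv i (L t) 0 / i.factorial * x ^ i := by
    simp [P, eval_finsetSum]
  rw [h5, norm_pow, Real.norm_eq_abs, Real.norm_eq_abs, add_mul]
  rw [abs_sub_comm] at h4
  refine (abs_sub_le _ (L t x) _).trans ?_
  rw [add_comm]
  exact add_le_add h3 h4

theorem SmoothAlongCurves.contDiff_iteratedDeriv {K : ℝ → ℝ → ℝ} (hK : SmoothAlongCurves K)
    (p : ℕ) : ContDiff ℝ ∞ fun t => iteratedDeriv p (K t) 0 := by
  refine contDiff_of_deriv_closed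
    {k | ∃ K p, SmoothAlongCurves K ∧ k = fun t => iteratedDeriv p (K t) 0} ?_ _ ⟨K, p, hK, rfl⟩
  rintro _ ⟨K, p, hK, rfl⟩
  obtain ⟨L, hL, h⟩ := hK.exists_hasDerivAt_iteratedDeriv p
  exact ⟨_, ⟨L, p + 1, hL, rfl⟩, h⟩

/-- Separate continuity suffices, since `exists_bound` with `p = 1` makes `K` Lipschitz in the
second variable, uniformly in the first. -/
theorem SmoothAlongCurves.continuous {K : ℝ → ℝ → ℝ} (hK : SmoothAlongCurves K) :
    Continuous fun p : ℝ × ℝ => K p.1 p.2 := by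
  rw [continuous_iff_continuousAt]
  rintro ⟨t₀, e₀⟩
  obtain ⟨C, r, hr, h⟩ := hK.exists_bound 1 t₀ e₀
  have h1 : Tendsto (fun p : ℝ × ℝ => C * |p.2 - e₀| + |K p.1 e₀ - K t₀ e₀|) (𝓝 (t₀, e₀)) (𝓝 0) := by
    have h2 : Continuous fun p : ℝ × ℝ => C * |p.2 - e₀| + |K p.1 e₀ - K t₀ e₀| := by
      have := (hK.contDiff_fst e₀).continuous
      fun_prop
    simpa using h2.tendsto (t₀, e₀)
  rw [ContinuousAt, tendsto_iff_dist_tendsto_zero]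
  refine squeeze_zero' (Eventually.of_forall fun _ => dist_nonneg) ?_ h1
  filter_upwards [Metric.ball_mem_nhds (t₀, e₀) hr] with p hp
  rw [Metric.mem_ball, Prod.dist_eq, max_lt_iff] at hp
  have h3 := (convex_ball e₀ r).norm_image_sub_le_of_norm_deriv_le (f := K p.1) (C := C)
    (fun x _ => (hK.contDiff_snd p.1).differentiable (by simp) x)
    (fun x hx => by rw [← iteratedDeriv_one]; exact h _ _ hp.1 hx)
    (Metric.mem_ball_self hr) (show p.2 ∈ Metric.ball e₀ r from hp.2)
  rw [Real.dist_eq]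
  exact (abs_sub_le _ (K p.1 e₀) _).trans (add_le_add h3 le_rfl)

/-- Boman's theorem in the plane. -/
theorem SmoothAlongCurves.contDiff {K : ℝ → ℝ → ℝ} (hK : SmoothAlongCurves K) :
    ContDiff ℝ ∞ fun p : ℝ × ℝ => K p.1 p.2 := by
  rw [← contDiffOn_univ]
  refine contDiffOn_of_partials_closed isOpen_univ {K | SmoothAlongCurves K}
    (fun K hK => hK.continuous.continuousOn) ?_ K hK
  intro K hK
  have key : ∀ {K : ℝ → ℝ → ℝ}, SmoothAlongCurves K → ∃ K₂, SmoothAlongCurves K₂ ∧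
      ∀ s t, HasDerivAt (K s) (K₂ s t) t := by
    intro K hK
    refine ⟨fun s t => deriv (K s) t, fun a b ha hb => ?_,
      fun s t => ((hK.contDiff_snd s).differentiable (by simp) t).hasDerivAt⟩
    -- Along a curve `(a, b)` the partial derivative is the derivative at `e = 0` of `K (a t) (e + b
    -- t)`, a function that is again smooth along curves.
    have := (hK.comp (f := fun t _ => a t) (g := fun t e => e + b t) (ha.comp _root_.contDiff_fst)
      (_root_.contDiff_snd.add (hb.comp _root_.contDiff_fst))).contDiff_iteratedDeriv 1
    simp_rw [iteratedDeriv_one] at this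
    convert this using 2 with t
    rw [deriv_comp_add_const, zero_add]
  have hK' : SmoothAlongCurves fun s t => K t s := fun a b ha hb => hK b a hb ha
  obtain ⟨K₂, hK₂, h₂⟩ := key hK
  obtain ⟨K₁, hK₁, h₁⟩ := key hK'
  exact ⟨fun s t => K₁ t s, fun a b ha hb => hK₁ b a hb ha, K₂, hK₂, fun p _ => ⟨h₁ p.2 p.1, h₂ p.1 p.2⟩⟩

end

/-! ### Cartesian closedness of Frölicher spaces -/

namespace FrolicherSpace

theorem const_mem_curves (X : FrolicherSpace) (x : X.carrier) : (fun _ => x) ∈ X.curves :=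
  (X.mem_curves_iff _).2 fun _ _ => contDiff_const

theorem comp_mem_curves {X : FrolicherSpace} {c : ℝ → X.carrier} (hc : c ∈ X.curves) {a : ℝ → ℝ}
    (ha : ContDiff ℝ ∞ a) : (fun s => c (a s)) ∈ X.curves :=
  (X.mem_curves_iff _).2 fun h hh => ((X.mem_curves_iff c).1 hc h hh).comp ha

theorem mem_Rn_curves {n : ℕ} {c : ℝ → Fin n → ℝ} :
    c ∈ (Rn n).curves ↔ ContDiff ℝ ∞ c := by
  refine ⟨fun hc => contDiff_pi.2 fun i => ?_, fun hc => subset_generate hc⟩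
  exact hc (fun x => x i) fun c₀ (hc₀ : ContDiff ℝ ∞ c₀) => contDiff_pi.1 hc₀ i

/-- The smooth curves of `X ^ Y` are the curves that are smooth as mappings `ℝ × Y → X`. -/
theorem mem_exp_curves {X Y : FrolicherSpace} {c : ℝ → (exp X Y).carrier} :
    c ∈ (exp X Y).curves ↔
      ∀ a : ℝ → ℝ, ContDiff ℝ ∞ a → ∀ d ∈ Y.curves, (fun s => ev (c (a s)) (d s)) ∈ X.curves := by
  refine ⟨fun hc a ha d hd => ?_, fun hc => subset_generate hc⟩
  rw [X.mem_curves_iff]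
  intro f hf
  -- For an admissible `Λ`, the function `u ↦ Λ (f ∘ u ∘ d)` on `X ^ Y` is smooth along the
  -- generators by Boman's theorem, hence along `c`.
  have main := contDiff_of_functionals (fun s t => f (ev (c s) (d t)))
    (fun s => (X.mem_curves_iff _).1 (Hom.smooth (c s) d hd) f hf) fun Λ hΛ => by
      refine hc (fun u => Λ fun t => f (ev u (d t))) fun c₀ hc₀ => ?_
      refine hΛ (fun s t => f (ev (c₀ s) (d t))) (SmoothAlongCurves.contDiff
        (K := fun s t => f (ev (c₀ s) (d t))) fun a b ha hb => ?_)
      exact (X.mem_curves_iff _).1 (hc₀ a ha _ (comp_mem_curves hd hb)) f hf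
  exact main.comp (ha.prodMk contDiff_id)

theorem ev_mem_curves {X Y : FrolicherSpace} {c : ℝ → (exp X Y).carrier} (hc : c ∈ (exp X Y).curves)
    {d : ℝ → Y.carrier} (hd : d ∈ Y.curves) : (fun s => ev (c s) (d s)) ∈ X.curves :=
  mem_exp_curves.1 hc id contDiff_id d hd

theorem uncurry_mem_curves {X Y Z : FrolicherSpace} (f : Hom Z (exp X Y)) {c : ℝ → Z.carrier}
    (hc : c ∈ Z.curves) {d : ℝ → Y.carrier} (hd : d ∈ Y.curves) :
    (fun s => ev (f.toFun (c s)) (d s)) ∈ X.curves :=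
  ev_mem_curves (f.smooth c hc) hd

/-- The smooth mapping `Z → X ^ Y` given by a smooth mapping in two variables. -/
def curryHom {X Y Z : FrolicherSpace} (F : Z.carrier → Y.carrier → X.carrier)
    (hF : ∀ c ∈ Z.curves, ∀ d ∈ Y.curves, (fun s => F (c s) (d s)) ∈ X.curves) :
    Hom Z (exp X Y) where
  toFun z := (⟨F z, fun d hd => hF _ (const_mem_curves Z z) d hd⟩ : Hom Y X)
  smooth _ hc := mem_exp_curves.2 fun _ ha d hd => hF _ (comp_mem_curves hc ha) d hd

theorem exp_ext {X Y : FrolicherSpace} {u v : (exp X Y).carrier} (h : ∀ y, ev u y = ev v y) :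
    u = v := Hom.ext (funext h)

/-- The product of Frölicher spaces. -/
def prod (Y Z : FrolicherSpace) : FrolicherSpace :=
  generate (Y.carrier × Z.carrier) {c | (fun s => (c s).1) ∈ Y.curves ∧ (fun s => (c s).2) ∈ Z.curves}

theorem mem_prod_curves {Y Z : FrolicherSpace} {c : ℝ → (prod Y Z).carrier} :
    c ∈ (prod Y Z).curves ↔ (fun s => (c s).1) ∈ Y.curves ∧ (fun s => (c s).2) ∈ Z.curves := by
  refine ⟨fun hc => ⟨?_, ?_⟩, fun hc => subset_generate hc⟩
  · rw [Y.mem_curves_iff]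
    exact fun h hh => hc (fun p => h p.1) fun c₀ hc₀ => (Y.mem_curves_iff _).1 hc₀.1 h hh
  · rw [Z.mem_curves_iff]
    exact fun h hh => hc (fun p => h p.2) fun c₀ hc₀ => (Z.mem_curves_iff _).1 hc₀.2 h hh

/-- The product of a smooth mapping with `Z`. -/
def prodMapLeft {Y Y' : FrolicherSpace} (g : Y ⟶ Y') (Z : FrolicherSpace) : prod Y Z ⟶ prod Y' Z :=
  ⟨fun p => (g.toFun p.1, p.2), fun _ hc => mem_prod_curves.2
    ⟨g.smooth _ (mem_prod_curves.1 hc).1, (mem_prod_curves.1 hc).2⟩⟩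

/-- The exponential law `A ^ (Z × Y) ≅ (A ^ Y) ^ Z`. -/
def curryIso (A Z Y : FrolicherSpace) : exp A (prod Z Y) ≅ exp (exp A Y) Z where
  hom := curryHom (fun u z => (⟨fun y => ev u (z, y), fun _ hd => Hom.smooth u _
      (mem_prod_curves.2 ⟨const_mem_curves Z z, hd⟩)⟩ : Hom Y A)) fun _ hc _ hd =>
    mem_exp_curves.2 fun _ ha _ he => ev_mem_curves (comp_mem_curves hc ha)
      (mem_prod_curves.2 ⟨comp_mem_curves hd ha, he⟩)
  inv := curryHom (fun u p => ev (ev u p.1) p.2) fun _ hc _ hd =>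
    ev_mem_curves (ev_mem_curves hc (mem_prod_curves.1 hd).1) (mem_prod_curves.1 hd).2
  hom_inv_id := rfl
  inv_hom_id := rfl

theorem curryIso_naturality {A A' Z Z' : FrolicherSpace} (f : A ⟶ A') (g : Z' ⟶ Z)
    (Y : FrolicherSpace) :
    (curryIso A Z Y).hom ≫ expMap (expMap f (𝟙 Y)) g =
      expMap f (prodMapLeft g Y) ≫ (curryIso A' Z' Y).hom := rfl

theorem expMap_comp {A A' A'' Y Y' Y'' : FrolicherSpace} (f : A ⟶ A') (f' : A' ⟶ A'')
    (g : Y' ⟶ Y) (g' : Y'' ⟶ Y') : expMap f g ≫ expMap f' g' = expMap (f ≫ f') (g' ≫ g) := rfl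

/-- Evaluation at a point as a smooth mapping. -/
def evalAt (X : FrolicherSpace) {Y : FrolicherSpace} (y : Y.carrier) : exp X Y ⟶ X :=
  ⟨fun u => ev u y, fun _ hc => ev_mem_curves hc (const_mem_curves Y y)⟩

/-- The constant mapping. -/
def constHom (Z : FrolicherSpace) {Y : FrolicherSpace} (y : Y.carrier) : Z ⟶ Y :=
  ⟨fun _ => y, fun _ _ => const_mem_curves Y y⟩

theorem Rn_zero_eq (x : (Rn 0).carrier) : x = (0 : Fin 0 → ℝ) :=
  funext fun i => i.elim0

/-- `A ≅ A ^ pt`. -/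
def constIso (A : FrolicherSpace) : A ≅ exp A (Rn 0) where
  hom := curryHom (fun x _ => x) fun _ hc _ _ => hc
  inv := evalAt A (Y := Rn 0) (0 : Fin 0 → ℝ)
  hom_inv_id := rfl
  inv_hom_id := by
    apply Hom.ext
    funext u
    refine exp_ext fun y => ?_
    obtain rfl := Rn_zero_eq y
    rfl

end FrolicherSpace

/-! ### The canonical mapping `X ^ Y ⊗ W → (X ⊗ W) ^ Y` -/

/-! ### The Weil algebra `ℝ` as a unit for `⊗_∞` -/

namespace WeilAlgebra

theorem Map.ext' {W W' : WeilAlgebra} {φ ψ : Map W W'} (h : φ.φ = ψ.φ) : φ = ψ := by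
  cases φ; cases ψ; cases h; rfl

/-- Composition of maps of Weil algebras. -/
def Map.comp {W W' W'' : WeilAlgebra} (φ : Map W W') (ψ : Map W' W'') : Map W W'' where
  φ := φ.φ ∘ ψ.φ
  contDiff := φ.contDiff.comp ψ.contDiff
  map_le F hF := ψ.map_le _ (φ.map_le F hF)

theorem append_pr {k l : ℕ} (x : Fin (k + l) → ℝ) : Fin.append (prFst k l x) (prSnd k l x) = x :=
  Fin.append_castAdd_natAdd

theorem Map.refl_tensor_refl (W₁ W₂ : WeilAlgebra) :
    (Map.refl W₁).tensor (Map.refl W₂) = Map.refl (W₁.tensor W₂) :=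
  Map.ext' (funext fun x => append_pr x)

/-- The Weil algebra `ℝ`. -/
def real : WeilAlgebra where
  k := 0
  I := ⊥
  vanish F hF := by
    rw [Ideal.mem_bot] at hF
    rw [hF]; rfl
  nilpotent := ⟨1, by simp [Set.range_eq_empty]⟩

/-- The unit isomorphism `W → ℝ ⊗_∞ W`. -/
def unitMap (W : WeilAlgebra) : Map W (real.tensor W) where
  φ := prSnd 0 W.k
  contDiff := contDiff_prSnd 0 W.k
  map_le _ hF := Ideal.mem_sup_right (Ideal.mem_map_of_mem _ hF)

theorem contDiff_append {E : Type} [NormedAddCommGroup E] [NormedSpace ℝ E] {k l : ℕ}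
    {f : E → Fin k → ℝ} {g : E → Fin l → ℝ} (hf : ContDiff ℝ ∞ f) (hg : ContDiff ℝ ∞ g) :
    ContDiff ℝ ∞ fun x => Fin.append (f x) (g x) := by
  refine contDiff_pi.2 fun i => ?_
  refine Fin.addCases (fun j => ?_) (fun j => ?_) i
  · simpa only [Fin.append_left] using contDiff_pi.1 hf j
  · simpa only [Fin.append_right] using contDiff_pi.1 hg j

theorem prFst_append {k l : ℕ} (x : Fin k → ℝ) (y : Fin l → ℝ) : prFst k l (Fin.append x y) = x :=
  funext fun i => Fin.append_left x y i

theorem prSnd_append {k l : ℕ} (x : Fin k → ℝ) (y : Fin l → ℝ) : prSnd k l (Fin.append x y) = y :=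
  funext fun i => Fin.append_right x y i

/-- The unit isomorphism `ℝ ⊗_∞ W → W`. -/
def unitMapInv (W : WeilAlgebra) : Map (real.tensor W) W where
  φ x := Fin.append (0 : Fin 0 → ℝ) x
  contDiff := contDiff_append contDiff_const contDiff_id
  map_le F hF := by
    have : (real.tensor W).I ≤ W.I.comap
        (pullback (fun x : Fin W.k → ℝ => (Fin.append (0 : Fin 0 → ℝ) x : Fin (0 + W.k) → ℝ))
          (contDiff_append contDiff_const contDiff_id)) := by
      refine sup_le ?_ (Ideal.map_le_iff_le_comap.2 fun G hG => ?_)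
      · change Ideal.map _ ⊥ ≤ _
        rw [Ideal.map_bot]
        exact bot_le
      · refine Eq.subst (motive := fun F => F ∈ W.I) (Subtype.ext (funext fun x => ?_)) hG
        exact congrArg G.1 (prSnd_append (0 : Fin 0 → ℝ) x).symm
    exact this hF

theorem unitMap_comp_inv (W : WeilAlgebra) : (unitMap W).comp (unitMapInv W) = Map.refl W :=
  Map.ext' (funext fun x => prSnd_append (0 : Fin 0 → ℝ) x)

theorem unitMapInv_comp (W : WeilAlgebra) :
    (unitMapInv W).comp (unitMap W) = Map.refl (real.tensor W) :=
  Map.ext' (funext fun x => by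
    refine Eq.trans ?_ (append_pr (k := 0) (l := W.k) x)
    exact congrArg (fun z : Fin 0 → ℝ => Fin.append z (prSnd 0 W.k x)) 
      (Subsingleton.elim (0 : Fin 0 → ℝ) (prFst 0 W.k x)))

end WeilAlgebra

open WeilAlgebra

theorem weilMap_comp {X X' X'' : FrolicherSpace} {W W' W'' : WeilAlgebra} (g : X ⟶ X')
    (g' : X' ⟶ X'') (φ : Map W W') (φ' : Map W' W'') :
    weilMap g φ ≫ weilMap g' φ' = weilMap (g ≫ g') (φ.comp φ') := by
  apply Hom.ext
  funext z
  induction z using Quotient.inductionOn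
  rfl

theorem weilMap_id (X : FrolicherSpace) (W : WeilAlgebra) : weilMap (𝟙 X) (Map.refl W) = 𝟙 _ := by
  apply Hom.ext
  funext z
  induction z using Quotient.inductionOn
  rfl

theorem weilMk_mem_curves {X : FrolicherSpace} {W : WeilAlgebra} {d : ℝ → (exp X (Rn W.k)).carrier}
    (hd : d ∈ (exp X (Rn W.k)).curves) :
    (fun s => weilMk (W := W) (X := X) (d s)) ∈ (weilProlongation X W).curves :=
  subset_generate ⟨d, hd, rfl⟩

/-- The isomorphism `X ⊗ W ≅ X' ⊗ W` given by an isomorphism `X ≅ X'`. -/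
def weilMapIso {X X' : FrolicherSpace} (e : X ≅ X') (W : WeilAlgebra) :
    weilProlongation X W ≅ weilProlongation X' W where
  hom := weilMap e.hom (Map.refl W)
  inv := weilMap e.inv (Map.refl W)
  hom_inv_id := by rw [weilMap_comp, e.hom_inv_id]; exact weilMap_id X W
  inv_hom_id := by rw [weilMap_comp, e.inv_hom_id]; exact weilMap_id X' W

/-- The isomorphism `A ^ Y ≅ A' ^ Y` given by an isomorphism `A ≅ A'`. -/
def expMapIso {A A' : FrolicherSpace} (e : A ≅ A') (Y : FrolicherSpace) : exp A Y ≅ exp A' Y where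
  hom := expMap e.hom (𝟙 Y)
  inv := expMap e.inv (𝟙 Y)
  hom_inv_id := by rw [expMap_comp, e.hom_inv_id]; rfl
  inv_hom_id := by rw [expMap_comp, e.inv_hom_id]; rfl

/-- The canonical mapping `X ^ Y ⊗ W → (X ⊗ W) ^ Y`, which sends `[f]` to `y ↦ [f (·) (y)]`. -/
def weilExpComparison (X Y : FrolicherSpace) (W : WeilAlgebra) :
    weilProlongation (exp X Y) W ⟶ exp (weilProlongation X W) Y :=
  ⟨fun z => (⟨fun y => (weilMap (evalAt X y) (Map.refl W)).toFun z, fun d hd => by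
      induction z using Quotient.inductionOn with | _ f => ?_
      refine weilMk_mem_curves (d := fun r => (f ≫ evalAt X (d r) : Rn W.k ⟶ X)) ?_
      exact mem_exp_curves.2 fun a ha e he =>
        uncurry_mem_curves f he (comp_mem_curves hd ha)⟩ : Hom Y (weilProlongation X W)), by
    refine smooth_of_generators (Y := exp (weilProlongation X W) Y) _ ?_
    rintro _ ⟨D, hD, rfl⟩
    refine mem_exp_curves.2 fun a ha d hd => ?_
    refine weilMk_mem_curves (d := fun r => (D (a r) ≫ evalAt X (d r) : Rn W.k ⟶ X)) ?_
    exact mem_exp_curves.2 fun b hb e he =>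
      ev_mem_curves (ev_mem_curves (comp_mem_curves hD (ha.comp hb)) he) (comp_mem_curves hd hb)⟩

theorem weilExpComparison_naturality (X : FrolicherSpace) (Y : FrolicherSpace)
    {W W' : WeilAlgebra} (φ : Map W W') :
    weilExpComparison X Y W ≫ expMap (weilMap (𝟙 X) φ) (𝟙 Y) =
      weilMap (𝟙 _) φ ≫ weilExpComparison X Y W' := by
  apply Hom.ext
  funext z
  induction z using Quotient.inductionOn
  rfl

/-- `X ⊗ ℝ ≅ X`. -/
def weilRealIso (X : FrolicherSpace) : weilProlongation X real ≅ X where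
  hom := ⟨Quotient.lift (fun f : Rn 0 ⟶ X => f.toFun (0 : Fin 0 → ℝ)) fun _ _ h => h.1,
    smooth_of_generators (Y := X) _ (by
      rintro _ ⟨d, hd, rfl⟩
      exact ev_mem_curves hd (const_mem_curves (Rn 0) (0 : Fin 0 → ℝ)))⟩
  inv := ⟨fun x => weilMk (constHom (Rn 0) x), fun c hc => weilMk_mem_curves (W := real)
    (d := fun r => (constHom (Rn 0) (c r) : Rn 0 ⟶ X))
    (mem_exp_curves.2 fun _ ha _ _ => comp_mem_curves hc ha)⟩
  hom_inv_id := by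
    apply Hom.ext
    funext z
    induction z using Quotient.inductionOn with | _ f => ?_
    refine congrArg (Quotient.mk _) (Hom.ext (funext fun x => ?_))
    obtain rfl := Rn_zero_eq x
    rfl
  inv_hom_id := rfl

/-- `X ⊗ W ≅ X ⊗ (ℝ ⊗_∞ W)`. -/
def weilUnitIso (X : FrolicherSpace) (W : WeilAlgebra) :
    weilProlongation X W ≅ weilProlongation X (real.tensor W) where
  hom := weilMap (𝟙 X) (unitMap W)
  inv := weilMap (𝟙 X) (unitMapInv W)
  hom_inv_id := by rw [weilMap_comp, unitMap_comp_inv]; exact weilMap_id X W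
  inv_hom_id := by rw [weilMap_comp, unitMapInv_comp]; exact weilMap_id X _

/-- For a Weil exponentiable space the canonical mapping is an isomorphism. -/
theorem isIso_weilExpComparison {X : FrolicherSpace} (hX : WeilExponentiable X) (Y : FrolicherSpace)
    (W : WeilAlgebra) : IsIso (weilExpComparison X Y W) := by
  obtain ⟨θ, hθ⟩ := hX
  -- The case `W₁ = ℝ` of the hypothesis: natural in `Y`, but not known to be inverse to the
  -- canonical mapping.
  let Φ : ∀ Y, exp (weilProlongation X W) Y ≅ weilProlongation (exp X Y) W := fun Y =>
    expMapIso (weilUnitIso X W) Y ≪≫ θ Y real W ≪≫ weilMapIso (expMapIso (weilRealIso X) Y) W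
  have hΦ : ∀ {Y Y' : FrolicherSpace} (g : Y' ⟶ Y),
      (Φ Y).hom ≫ weilMap (expMap (𝟙 X) g) (Map.refl W) = expMap (𝟙 _) g ≫ (Φ Y').hom := by
    intro Y Y' g
    have h := hθ Y Y' g real real W W (Map.refl _) (Map.refl _)
    rw [Map.refl_tensor_refl, weilMap_id, weilMap_id] at h
    change (expMap _ (𝟙 Y) ≫ (θ Y real W).hom ≫ weilMap (expMap (weilRealIso X).hom (𝟙 Y)) (Map.refl W)) ≫ _ =
      _ ≫ expMap _ (𝟙 Y') ≫ (θ Y' real W).hom ≫ weilMap (expMap (weilRealIso X).hom (𝟙 Y')) (Map.refl W)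
    have h1 : weilMap (expMap (weilRealIso X).hom (𝟙 Y)) (Map.refl W) ≫
        weilMap (expMap (𝟙 X) g) (Map.refl W) = weilMap (expMap (𝟙 _) g) (Map.refl W) ≫
        weilMap (expMap (weilRealIso X).hom (𝟙 Y')) (Map.refl W) := by
      rw [weilMap_comp, weilMap_comp]; rfl
    rw [Category.assoc, Category.assoc, h1, reassoc_of% h]
    rfl
  -- The discrepancy between `Φ` and the canonical mapping, computed over the one-point space `Rn
  -- 0`.
  let η : weilProlongation X W ≅ weilProlongation X W :=
    constIso _ ≪≫ Φ (Rn 0) ≪≫ weilMapIso (constIso X).symm W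
  have key : (Φ Y).hom ≫ weilExpComparison X Y W = expMap η.hom (𝟙 Y) := by
    apply Hom.ext
    funext z
    refine exp_ext fun y => ?_
    -- Naturality along the point `y` of `Y` reduces the value at `y` to the one-point space.
    have h := congrFun (congrArg Hom.toFun (hΦ (constHom (Rn 0) y))) z
    have h2 : weilMap (evalAt X y) (Map.refl W) =
        weilMap (expMap (𝟙 X) (constHom (Rn 0) y)) (Map.refl W) ≫
          weilMap (constIso X).inv (Map.refl W) := by
      rw [weilMap_comp]; rfl
    change (weilMap (evalAt X y) (Map.refl W)).toFun ((Φ Y).hom.toFun z) = _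
    rw [h2]
    exact congrArg (weilMap (constIso X).inv (Map.refl W)).toFun h
  have : IsIso ((Φ Y).hom ≫ weilExpComparison X Y W) := by
    rw [key]
    exact (expMapIso η Y).isIso_hom
  exact IsIso.of_isIso_comp_left (Φ Y).hom _

/-- `X ^ Y ⊗ W ≅ (X ⊗ W) ^ Y` for a Weil exponentiable space `X`. -/
def weilExpIso {X : FrolicherSpace} (hX : WeilExponentiable X) (Y : FrolicherSpace)
    (W : WeilAlgebra) : weilProlongation (exp X Y) W ≅ exp (weilProlongation X W) Y :=
  have := isIso_weilExpComparison hX Y W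
  asIso (weilExpComparison X Y W)

/-- Exponentials of Weil exponentiable spaces are Weil exponentiable. -/
theorem WeilExponentiable.exp {X : FrolicherSpace} (hX : WeilExponentiable X) (Y : FrolicherSpace) :
    WeilExponentiable (exp X Y) := by
  obtain ⟨θ, hθ⟩ := id hX
  -- With `V = W₁ ⊗_∞ W₂`: `(X ^ Y ⊗ V) ^ Z ≅ ((X ⊗ V) ^ Y) ^ Z ≅ (X ⊗ V) ^ (Z × Y) ≅ (X ⊗ W₁) ^ (Z
  -- × Y) ⊗ W₂ ≅ ((X ⊗ W₁) ^ Y) ^ Z ⊗ W₂ ≅ (X ^ Y ⊗ W₁) ^ Z ⊗ W₂`.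
  refine ⟨fun Z W₁ W₂ => expMapIso (weilExpIso hX Y (W₁.tensor W₂)) Z ≪≫
    (curryIso _ Z Y).symm ≪≫ θ (prod Z Y) W₁ W₂ ≪≫ weilMapIso (curryIso _ Z Y) W₂ ≪≫
    weilMapIso (expMapIso (weilExpIso hX Y W₁).symm Z) W₂, ?_⟩
  intro Z Z' g W₁ W₁' W₂ W₂' φ₁ φ₂
  have h1 : ∀ {W W' : WeilAlgebra} (φ : Map W W'), (weilExpIso hX Y W).hom ≫
      expMap (weilMap (𝟙 X) φ) (𝟙 Y) = weilMap (𝟙 _) φ ≫ (weilExpIso hX Y W').hom :=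
    fun φ => weilExpComparison_naturality X Y φ
  have h2 : ∀ {W W' : WeilAlgebra} (φ : Map W W'), (weilExpIso hX Y W).inv ≫ weilMap (𝟙 _) φ =
      expMap (weilMap (𝟙 X) φ) (𝟙 Y) ≫ (weilExpIso hX Y W').inv := fun φ => by
    rw [Iso.inv_comp_eq, ← Category.assoc, h1, Category.assoc, Iso.hom_inv_id, Category.comp_id]
  have h3 : (curryIso (weilProlongation X (W₁.tensor W₂)) Z Y).inv ≫
      expMap (weilMap (𝟙 X) (φ₁.tensor φ₂)) (prodMapLeft g Y) =
      expMap (expMap (weilMap (𝟙 X) (φ₁.tensor φ₂)) (𝟙 Y)) g ≫ (curryIso _ Z' Y).inv := by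
    rw [Iso.inv_comp_eq, ← Category.assoc, curryIso_naturality, Category.assoc, Iso.hom_inv_id,
      Category.comp_id]
  have h4 : weilMap (curryIso _ Z Y).hom (Map.refl W₂) ≫
      weilMap (expMap (weilExpIso hX Y W₁).inv (𝟙 Z)) (Map.refl W₂) ≫
        weilMap (expMap (weilMap (𝟙 _) φ₁) g) φ₂ =
      weilMap (expMap (weilMap (𝟙 X) φ₁) (prodMapLeft g Y)) φ₂ ≫
        weilMap (curryIso _ Z' Y).hom (Map.refl W₂') ≫
          weilMap (expMap (weilExpIso hX Y W₁').inv (𝟙 Z')) (Map.refl W₂') := by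
    simp only [weilMap_comp, expMap_comp, h2]
    rw [← Category.assoc, ← curryIso_naturality]
    rfl
  change (expMap (weilExpIso hX Y (W₁.tensor W₂)).hom (𝟙 Z) ≫ (curryIso _ Z Y).inv ≫
      (θ (prod Z Y) W₁ W₂).hom ≫ weilMap (curryIso _ Z Y).hom (Map.refl W₂) ≫
      weilMap (expMap (weilExpIso hX Y W₁).inv (𝟙 Z)) (Map.refl W₂)) ≫ _ =
    _ ≫ expMap (weilExpIso hX Y (W₁'.tensor W₂')).hom (𝟙 Z') ≫ (curryIso _ Z' Y).inv ≫
      (θ (prod Z' Y) W₁' W₂').hom ≫ weilMap (curryIso _ Z' Y).hom (Map.refl W₂') ≫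
      weilMap (expMap (weilExpIso hX Y W₁').inv (𝟙 Z')) (Map.refl W₂')
  simp only [Category.assoc]
  rw [h4, reassoc_of% (hθ (prod Z Y) (prod Z' Y) (prodMapLeft g Y) W₁ W₁' W₂ W₂' φ₁ φ₂),
    reassoc_of% h3, ← Category.assoc, ← Category.assoc (expMap (weilMap _ _) g)]
  congr 1
  rw [expMap_comp, expMap_comp, ← h1]
  rfl

/-! ### Morphisms of `D` -/

namespace DObj

/-- The underlying space `ℝⁿ × ℝᵏ` of the generators of `C^∞(ℝⁿ) ⊗_∞ W`. -/
abbrev Dom (C : DObj) : Type := (Fin C.n → ℝ) × (Fin C.W.k → ℝ)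

/-- The morphism `[F] ↦ [F ∘ φ]` of `D`. -/
def substHom {C C' : DObj} (φ : C'.Dom → C.Dom) (hφ : ContDiff ℝ ∞ φ)
    (h : ∀ F ∈ C.W.I, pullback φ hφ (pullback Prod.snd contDiff_snd F) ∈ C'.ideal) : C ⟶ C' :=
  have hJ : ∀ F ∈ C.ideal, Ideal.Quotient.mk C'.ideal (pullback φ hφ F) = 0 := fun F hF =>
    Ideal.Quotient.eq_zero_iff_mem.2
      ((Ideal.map_le_iff_le_comap.2 h : C.ideal ≤ C'.ideal.comap (pullback φ hφ)) hF)
  have hout : ∀ z : SmoothFun C.Dom ⧸ C.ideal, Ideal.Quotient.mk C'.ideal (pullback φ hφ z.out) =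
      Ideal.Quotient.lift C.ideal ((Ideal.Quotient.mk C'.ideal).comp (pullback φ hφ).toRingHom) hJ z :=
    fun z => by
      conv_rhs => rw [← Ideal.Quotient.mk_out z]
      rfl
  InducedCategory.homMk (F := toCInfAlgebra)
    (⟨Ideal.Quotient.lift C.ideal
        ((Ideal.Quotient.mk C'.ideal).comp (pullback φ hφ).toRingHom) hJ, fun u a => by
      change Ideal.Quotient.mk C'.ideal (subst u fun i => pullback φ hφ (a i).out) = _
      refine mk_subst_congr C'.ideal u fun i => ?_
      rw [Ideal.Quotient.mk_out]
      exact hout (a i)⟩ : CInfAlgebra.Hom C.toCInfAlgebra C'.toCInfAlgebra)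

theorem isSubst_substHom {C C' : DObj} (φ : C'.Dom → C.Dom) (hφ : ContDiff ℝ ∞ φ)
    (h : ∀ F ∈ C.W.I, pullback φ hφ (pullback Prod.snd contDiff_snd F) ∈ C'.ideal) :
    IsSubst (substHom φ hφ h) φ hφ := fun _ => rfl

theorem IsSubst.hom_ext {C C' : DObj} {ψ ψ' : C ⟶ C'} {φ : C'.Dom → C.Dom} {hφ : ContDiff ℝ ∞ φ}
    (h : IsSubst ψ φ hφ) (h' : IsSubst ψ' φ hφ) : ψ = ψ' := by
  apply InducedCategory.hom_ext
  apply CInfAlgebra.Hom.ext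
  funext z
  obtain ⟨F, rfl⟩ := Ideal.Quotient.mk_surjective z
  exact (h F).trans (h' F).symm

theorem IsSubst.comp {C C' C'' : DObj} {ψ : C ⟶ C'} {χ : C' ⟶ C''} {φ : C'.Dom → C.Dom}
    {hφ : ContDiff ℝ ∞ φ} {φ' : C''.Dom → C'.Dom} {hφ' : ContDiff ℝ ∞ φ'}
    (h : IsSubst ψ φ hφ) (h' : IsSubst χ φ' hφ') : IsSubst (ψ ≫ χ) (φ ∘ φ') (hφ.comp hφ') := by
  intro F
  change χ.hom.toFun (ψ.hom.toFun _) = _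
  rw [h, h']
  rfl

/-- Every morphism of `D` is a substitution. -/
theorem exists_isSubst {C C' : DObj} (ψ : C ⟶ C') : ∃ φ hφ, IsSubst ψ φ hφ := by
  let crd : Fin (C.n + C.W.k) → SmoothFun C.Dom := fun i =>
    ⟨fun x => Fin.append x.1 x.2 i, contDiff_pi.1 (contDiff_append contDiff_fst contDiff_snd) i⟩
  -- Representatives of the images of the coordinates are the components of `φ`. Every `F` is an
  -- operation applied to the coordinates, so these images determine `ψ`.
  let b : Fin (C.n + C.W.k) → SmoothFun C'.Dom := fun i =>
    (ψ.hom.toFun (Ideal.Quotient.mk C.ideal (crd i))).out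
  have hb : ∀ i, Ideal.Quotient.mk C'.ideal (b i) =
      ψ.hom.toFun (Ideal.Quotient.mk C.ideal (crd i)) := fun i => Ideal.Quotient.mk_out _
  have hbs : ContDiff ℝ ∞ fun x i => (b i).1 x := contDiff_pi.2 fun i => isSmooth (b i)
  have hspl : ContDiff ℝ ∞ fun w : Fin (C.n + C.W.k) → ℝ => (prFst C.n C.W.k w, prSnd C.n C.W.k w) :=
    (contDiff_prFst _ _).prodMk (contDiff_prSnd _ _)
  refine ⟨_, hspl.comp hbs, fun F => ?_⟩
  let u : SmoothFun (Fin (C.n + C.W.k) → ℝ) := pullback _ hspl F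
  have h1 : subst u crd = F := by
    apply Subtype.ext
    funext x
    change F.1 (prFst _ _ (Fin.append x.1 x.2), prSnd _ _ (Fin.append x.1 x.2)) = F.1 x
    rw [prFst_append, prSnd_append]
  have h2 : Ideal.Quotient.mk C.ideal F =
      C.toCInfAlgebra.op u fun i => Ideal.Quotient.mk C.ideal (crd i) := by
    conv_lhs => rw [← h1]
    exact mk_subst_congr C.ideal u fun i => (Ideal.Quotient.mk_out _).symm
  refine (congrArg ψ.hom.toFun h2).trans ((ψ.hom.map_op u _).trans ?_)
  rfl

end DObj

open DObj

/-! ### Representatives of elements of `X ⊗ C` -/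

theorem value_mem_curves {X : FrolicherSpace} {n k : ℕ} (f : Hom (Rn k) (exp X (Rn n)))
    {a : ℝ → Fin n → ℝ} (ha : ContDiff ℝ ∞ a) {b : ℝ → Fin k → ℝ} (hb : ContDiff ℝ ∞ b) :
    (fun r => value f (a r) (b r)) ∈ X.curves :=
  uncurry_mem_curves f (mem_Rn_curves.2 hb) (mem_Rn_curves.2 ha)

/-- The smooth mapping `ℝᵏ → X ^ ℝⁿ` with the given values. -/
def ofValue {X : FrolicherSpace} {n k : ℕ} (F : (Fin n → ℝ) → (Fin k → ℝ) → X.carrier)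
    (hF : ∀ a b, ContDiff ℝ ∞ a → ContDiff ℝ ∞ b → (fun r : ℝ => F (a r) (b r)) ∈ X.curves) :
    Hom (Rn k) (exp X (Rn n)) :=
  curryHom (Z := Rn k) (Y := Rn n) (fun s t => F t s) fun _ hc _ hd =>
    hF _ _ (mem_Rn_curves.1 hd) (mem_Rn_curves.1 hc)

theorem value_ext {X : FrolicherSpace} {n k : ℕ} {f g : Hom (Rn k) (exp X (Rn n))}
    (h : ∀ t s, value f t s = value g t s) : f = g :=
  Hom.ext (funext fun s => exp_ext fun t => h t s)

/-- The composite `f ∘ φ`. -/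
def reindex {X : FrolicherSpace} {C C' : DObj} (f : Hom (Rn C.W.k) (exp X (Rn C.n)))
    (φ : C'.Dom → C.Dom) (hφ : ContDiff ℝ ∞ φ) : Hom (Rn C'.W.k) (exp X (Rn C'.n)) :=
  ofValue (fun t s => value f (φ (t, s)).1 (φ (t, s)).2) fun _ _ ha hb =>
    value_mem_curves f (hφ.comp (ha.prodMk hb)).fst (hφ.comp (ha.prodMk hb)).snd

theorem prolongMk_surjective {X : FrolicherSpace} {C : DObj} (z : (prolong X C).carrier) :
    ∃ f, z = prolongMk C f := by
  induction z using Quotient.inductionOn with | _ f => exact ⟨f, rfl⟩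

namespace FunctorialInD

theorem map_prolongMk (T : FunctorialInD) (X : FSWE) {C C' : DObj} {ψ : C ⟶ C'}
    {φ : C'.Dom → C.Dom} {hφ : ContDiff ℝ ∞ φ} (h : IsSubst ψ φ hφ)
    (f : Hom (Rn C.W.k) (exp X.obj (Rn C.n))) :
    (T.map X ψ).toFun (prolongMk C f) = prolongMk C' (reindex f φ hφ) :=
  T.map_subst X ψ φ hφ h f _ fun _ _ => rfl

end FunctorialInD

/-! ### Evaluation -/

/-- Restriction to the diagonal, `C^∞(ℝⁿ × ℝⁿ × ℝᵏ) ⊗_∞ W → C^∞(ℝⁿ) ⊗_∞ W`. -/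
def diagMap (C : DObj) : (⟨C.n + (C.n + C.W.k), C.W⟩ : DObj) ⟶ C :=
  substHom (C := ⟨C.n + (C.n + C.W.k), C.W⟩) (fun x => (Fin.append x.1 (Fin.append x.1 x.2), x.2))
    ((contDiff_append contDiff_fst (contDiff_append contDiff_fst contDiff_snd)).prodMk contDiff_snd)
    fun _ hF => Ideal.mem_map_of_mem _ hF

/-- The mapping `(X ^ ℝᴺ) ^ ℝⁿ → X ^ ℝⁿ⁺ᴺ`. -/
def uncurryRn (X : FrolicherSpace) (n N : ℕ) : exp (exp X (Rn N)) (Rn n) ⟶ exp X (Rn (n + N)) :=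
  curryHom (fun u w => ev (ev u (prFst n N w)) (prSnd n N w)) fun _ hc _ hd =>
    ev_mem_curves (ev_mem_curves hc (mem_Rn_curves.2 ((contDiff_prFst n N).comp (mem_Rn_curves.1 hd))))
      (mem_Rn_curves.2 ((contDiff_prSnd n N).comp (mem_Rn_curves.1 hd)))

/-- Restriction to the diagonal substitutes for the variables of `ℝⁿ⁺ᵏ` the point `(t, s)` itself.
It leaves the Weil variables of `C.W` alone, so it is a morphism of `D`, and the assumed
functoriality makes it act on classes. -/
theorem diag_congr (T : FunctorialInD) (X : FSWE) {C : DObj}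
    {q q' : Hom (Rn C.W.k) (exp (exp X.obj (Rn (C.n + C.W.k))) (Rn C.n))}
    (h : prolongMk C q = prolongMk C q') {k k' : Hom (Rn C.W.k) (exp X.obj (Rn C.n))}
    (hk : ∀ t s, value k t s = ev (value q t s) (Fin.append t s : Fin (C.n + C.W.k) → ℝ))
    (hk' : ∀ t s, value k' t s = ev (value q' t s) (Fin.append t s : Fin (C.n + C.W.k) → ℝ)) :
    prolongMk C k = prolongMk C k' := by
  let D : DObj := ⟨C.n + (C.n + C.W.k), C.W⟩
  have key : ∀ (q : Hom (Rn C.W.k) (exp (exp X.obj (Rn (C.n + C.W.k))) (Rn C.n)))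
      (k : Hom (Rn C.W.k) (exp X.obj (Rn C.n))),
      (∀ t s, value k t s = ev (value q t s) (Fin.append t s : Fin (C.n + C.W.k) → ℝ)) →
      (T.map X (diagMap C)).toFun ((weilMap (uncurryRn X.obj C.n (C.n + C.W.k)) (Map.refl C.W)).toFun
        (prolongMk C q)) = prolongMk C k := by
    intro q k hk
    have e : (weilMap (uncurryRn X.obj C.n (C.n + C.W.k)) (Map.refl C.W)).toFun (prolongMk C q) =
      prolongMk D ((q : Rn C.W.k ⟶ _) ≫ uncurryRn X.obj C.n (C.n + C.W.k) : Rn C.W.k ⟶ _) := rfl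
    rw [e]
    refine T.map_subst X _ _ _ (isSubst_substHom _ _ _) _ _ fun t s => ?_
    rw [hk]
    change _ = ev (ev (q.toFun s) (prFst C.n (C.n + C.W.k) (Fin.append t (Fin.append t s))))
      (prSnd C.n (C.n + C.W.k) (Fin.append t (Fin.append t s)))
    rw [prFst_append, prSnd_append]
    rfl
  rw [← key q k hk, ← key q' k' hk', h]

/-- The mapping `(t, s) ↦ f (t, s) (g (t, s))`. -/
def evalRep {X Y : FrolicherSpace} {n k : ℕ} (g : Hom (Rn k) (exp Y (Rn n)))
    (f : Hom (Rn k) (exp (exp X Y) (Rn n))) : Hom (Rn k) (exp X (Rn n)) :=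
  ofValue (fun t s => ev (value f t s) (value g t s)) fun _ _ ha hb =>
    ev_mem_curves (value_mem_curves f ha hb) (value_mem_curves g ha hb)

/-- With `g` fixed, precomposition with `g : ℝⁿ⁺ᵏ → Y` is a smooth mapping `X ^ Y → X ^ ℝⁿ⁺ᵏ`, and
evaluation is its prolongation followed by the diagonal. -/
theorem evalRep_congr_right (T : FunctorialInD) (X : FSWE) (Y : FrolicherSpace) {C : DObj}
    (g : Hom (Rn C.W.k) (exp Y (Rn C.n))) {f f' : Hom (Rn C.W.k) (exp (exp X.obj Y) (Rn C.n))}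
    (h : prolongMk C f = prolongMk C f') :
    prolongMk C (evalRep g f) = prolongMk C (evalRep g f') := by
  let G : Rn (C.n + C.W.k) ⟶ Y := ⟨fun w => value g (prFst _ _ w) (prSnd _ _ w), fun c hc =>
    value_mem_curves g ((contDiff_prFst _ _).comp (mem_Rn_curves.1 hc))
      ((contDiff_prSnd _ _).comp (mem_Rn_curves.1 hc))⟩
  let P := prolongMap (expMap (𝟙 X.obj) G) C
  have hv : ∀ f : Hom (Rn C.W.k) (exp (exp X.obj Y) (Rn C.n)), ∀ t s, value (evalRep g f) t s =
      ev (value ((f : Rn C.W.k ⟶ _) ≫ expMap (expMap (𝟙 X.obj) G) (𝟙 (Rn C.n)) :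
        Rn C.W.k ⟶ exp (exp X.obj (Rn (C.n + C.W.k))) (Rn C.n)) t s)
        (Fin.append t s : Fin (C.n + C.W.k) → ℝ) := by
    intro f t s
    change ev (value f t s) (value g t s) = ev (value f t s)
      (value g (prFst _ _ (Fin.append t s)) (prSnd _ _ (Fin.append t s)))
    rw [prFst_append, prSnd_append]
  exact diag_congr T X (congrArg P.toFun h) (hv f) (hv f')

/-- With `f` fixed, the same argument uses the smooth mapping `Y → X ^ ℝⁿ⁺ᵏ`, `y ↦ ((t, s) ↦ f (t,
s) (y))`. -/
theorem evalRep_congr_left (T : FunctorialInD) (X : FSWE) (Y : FrolicherSpace) {C : DObj}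
    {g g' : Hom (Rn C.W.k) (exp Y (Rn C.n))} (f : Hom (Rn C.W.k) (exp (exp X.obj Y) (Rn C.n)))
    (h : prolongMk C g = prolongMk C g') :
    prolongMk C (evalRep g f) = prolongMk C (evalRep g' f) := by
  let G : Y ⟶ exp X.obj (Rn (C.n + C.W.k)) :=
    curryHom (fun y w => ev (value f (prFst C.n C.W.k w) (prSnd C.n C.W.k w)) y) fun _ hc _ hd =>
      ev_mem_curves (value_mem_curves f ((contDiff_prFst _ _).comp (mem_Rn_curves.1 hd))
        ((contDiff_prSnd _ _).comp (mem_Rn_curves.1 hd))) hc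
  have hv : ∀ g : Hom (Rn C.W.k) (exp Y (Rn C.n)), ∀ t s, value (evalRep g f) t s =
      ev (value ((g : Rn C.W.k ⟶ _) ≫ expMap G (𝟙 (Rn C.n)) :
        Rn C.W.k ⟶ exp (exp X.obj (Rn (C.n + C.W.k))) (Rn C.n)) t s)
        (Fin.append t s : Fin (C.n + C.W.k) → ℝ) := by
    intro g t s
    change ev (value f t s) (value g t s) =
      ev (value f (prFst _ _ (Fin.append t s)) (prSnd _ _ (Fin.append t s))) (value g t s)
    rw [prFst_append, prSnd_append]
  exact diag_congr T X (congrArg (prolongMap G C).toFun h) (hv g) (hv g')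

/-- The mapping `([g], [f]) ↦ [ev (f, g)]`. -/
def evalProlong (T : FunctorialInD) (X : FSWE) (Y : FrolicherSpace) (C : DObj)
    (z : (prolong Y C).carrier) (w : (prolong (exp X.obj Y) C).carrier) : (prolong X.obj C).carrier :=
  Quotient.lift₂ (fun (g : Hom (Rn C.W.k) (exp Y (Rn C.n)))
      (f : Hom (Rn C.W.k) (exp (exp X.obj Y) (Rn C.n))) => prolongMk C (evalRep g f))
    (fun _ _ _ _ hg hf => (evalRep_congr_left T X Y _ (Quotient.sound hg)).trans
      (evalRep_congr_right T X Y _ (Quotient.sound hf))) z w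

theorem evalProlong_mk (T : FunctorialInD) (X : FSWE) (Y : FrolicherSpace) (C : DObj)
    (g : Hom (Rn C.W.k) (exp Y (Rn C.n))) (f : Hom (Rn C.W.k) (exp (exp X.obj Y) (Rn C.n))) :
    evalProlong T X Y C (prolongMk C g) (prolongMk C f) = prolongMk C (evalRep g f) := rfl

/-- The exponential `X ^ Y` in `FS_WE`. -/
def expFSWE (X Y : FSWE) : FSWE := ⟨exp X.obj Y.obj, X.property.exp Y.obj⟩

/-- On representatives a morphism of `D` is composition with one `φ`, which commutes with pointwise
evaluation. -/
theorem evalProlong_naturality (T : FunctorialInD) (X Y : FSWE) {C C' : DObj} (ψ : C ⟶ C')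
    (z : (prolong Y.obj C).carrier) (w : (prolong (exp X.obj Y.obj) C).carrier) :
    evalProlong T X Y.obj C' ((T.map Y ψ).toFun z) ((T.map (expFSWE X Y) ψ).toFun w) =
      (T.map X ψ).toFun (evalProlong T X Y.obj C z w) := by
  obtain ⟨g, rfl⟩ := prolongMk_surjective z
  obtain ⟨f, rfl⟩ := prolongMk_surjective w
  obtain ⟨φ, hφ, h⟩ := exists_isSubst ψ
  rw [T.map_prolongMk Y h, evalProlong_mk, T.map_prolongMk X h]
  exact congrArg (evalProlong T X Y.obj C' _) (T.map_prolongMk (expFSWE X Y) h f)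

/-- Evaluation `J Y ⊗ J (X ^ Y) ⟶ J X`. -/
def evalNat (T : FunctorialInD) (X Y : FSWE) :
    (J T).obj Y ⊗ (J T).obj (expFSWE X Y) ⟶ (J T).obj X where
  app C := ↾fun p : (prolong Y.obj C).carrier × (prolong (exp X.obj Y.obj) C).carrier =>
    evalProlong T X Y.obj C p.1 p.2
  naturality C C' ψ := by
    ext p
    exact evalProlong_naturality T X Y ψ p.1 p.2

/-! ### Elements of `J X ^ J Y` -/

theorem DObj.IsSubst.congr {C C' : DObj} {ψ : C ⟶ C'} {φ φ' : C'.Dom → C.Dom} {hφ : ContDiff ℝ ∞ φ}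
    (h : IsSubst ψ φ hφ) (e : φ = φ') : IsSubst ψ φ' (e ▸ hφ) := by
  subst e
  exact h

/-- The morphism `C^∞(ℝⁿ) ⊗_∞ W → C^∞(ℝᴺ) ⊗_∞ W` given by a smooth map `ℝᴺ → ℝⁿ`. -/
def baseMap (C : DObj) {N : ℕ} (a : (Fin N → ℝ) → Fin C.n → ℝ) (ha : ContDiff ℝ ∞ a) :
    C ⟶ ⟨N, C.W⟩ :=
  substHom (C' := ⟨N, C.W⟩) (fun x => (a x.1, x.2)) ((ha.comp contDiff_fst).prodMk contDiff_snd)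
    fun _ hF => Ideal.mem_map_of_mem _ hF

/-- The element of `Y ⊗ (C^∞(ℝᴺ) ⊗_∞ W)` given by a smooth mapping `ℝᴺ → Y`. -/
def pureProlong {Y : FrolicherSpace} (W : WeilAlgebra) {N : ℕ} (g : Rn N ⟶ Y) :
    (prolong Y ⟨N, W⟩).carrier :=
  prolongMk ⟨N, W⟩ (ofValue (fun t _ => g.toFun t) fun _ _ ha _ => g.smooth _ (mem_Rn_curves.2 ha))

/-- The value of an element of `X ⊗ (C^∞(ℝⁿ) ⊗_∞ W)` at a point of `ℝⁿ`, an element of `X ⊗ W`. -/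
def atPoint {X : FrolicherSpace} {C : DObj} (z : (prolong X C).carrier) (t : Fin C.n → ℝ) :
    (weilProlongation X C.W).carrier :=
  ev ((weilExpComparison X (Rn C.n) C.W).toFun z) t

theorem weilExpComparison_injective {X : FrolicherSpace} (hX : WeilExponentiable X)
    (Y : FrolicherSpace) (W : WeilAlgebra) :
    Function.Injective (weilExpComparison X Y W).toFun := fun z z' h => by
  have e := congrArg Hom.toFun (weilExpIso hX Y W).hom_inv_id
  exact (congrFun e z).symm.trans ((congrArg (weilExpIso hX Y W).inv.toFun h).trans (congrFun e z'))

theorem weilExpComparison_surjective {X : FrolicherSpace} (hX : WeilExponentiable X)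
    (Y : FrolicherSpace) (W : WeilAlgebra) :
    Function.Surjective (weilExpComparison X Y W).toFun := fun z =>
  ⟨(weilExpIso hX Y W).inv.toFun z, congrFun (congrArg Hom.toFun (weilExpIso hX Y W).inv_hom_id) z⟩

/-- Points of `ℝⁿ` separate the elements of `X ⊗ C` because the canonical mapping into `(X ⊗ W) ^
ℝⁿ` is injective. -/
theorem atPoint_ext {X : FrolicherSpace} (hX : WeilExponentiable X) {C : DObj}
    {z z' : (prolong X C).carrier} (h : ∀ t, atPoint z t = atPoint z' t) : z = z' :=
  weilExpComparison_injective hX (Rn C.n) C.W (exp_ext h)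

theorem atPoint_map_baseMap (T : FunctorialInD) (X : FSWE) (C : DObj) {N : ℕ}
    (a : (Fin N → ℝ) → Fin C.n → ℝ) (ha : ContDiff ℝ ∞ a) (z : (prolong X.obj C).carrier)
    (x : Fin N → ℝ) :
    atPoint (C := ⟨N, C.W⟩) ((T.map X (baseMap C a ha)).toFun z) x = atPoint z (a x) := by
  obtain ⟨f, rfl⟩ := prolongMk_surjective z
  exact (congrArg (fun v => atPoint (C := ⟨N, C.W⟩) v x)
    (T.map_prolongMk X (isSubst_substHom _ _ _) f)).trans rfl

theorem baseMap_comp (C : DObj) {M N : ℕ} (a : (Fin M → ℝ) → Fin C.n → ℝ) (ha : ContDiff ℝ ∞ a)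
    (b : (Fin N → ℝ) → Fin M → ℝ) (hb : ContDiff ℝ ∞ b) :
    baseMap C a ha ≫ baseMap ⟨M, C.W⟩ b hb = baseMap C (a ∘ b) (ha.comp hb) :=
  ((isSubst_substHom _ _ _).comp (isSubst_substHom _ _ _)).hom_ext (isSubst_substHom _ _ _)

theorem map_pureProlong (T : FunctorialInD) (Y : FSWE) (W : WeilAlgebra) {M N : ℕ}
    (a : (Fin N → ℝ) → Fin M → ℝ) (ha : ContDiff ℝ ∞ a) (g : Rn M ⟶ Y.obj) :
    (T.map Y (baseMap ⟨M, W⟩ a ha)).toFun (pureProlong W g) = pureProlong W (RnMap a ha ≫ g) :=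
  T.map_prolongMk Y (isSubst_substHom _ _ _) _

section HomObj

variable (T : FunctorialInD) {X Y : FSWE} {C : DObj}

/-- The component at `ψ : C ⟶ C'` of an element of `(J X ^ J Y) (C)`. -/
def component (α : (((J T).obj Y).functorHom ((J T).obj X)).obj C) {C' : DObj} (ψ : C ⟶ C')
    (z : (prolong Y.obj C').carrier) : (prolong X.obj C').carrier :=
  (α.app C' ψ : _ ⟶ _) z

theorem component_naturality (α : (((J T).obj Y).functorHom ((J T).obj X)).obj C) {C' C'' : DObj}
    (ψ : C ⟶ C') (χ : C' ⟶ C'') (z : (prolong Y.obj C').carrier) :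
    component T α (ψ ≫ χ) ((T.map Y χ).toFun z) = (T.map X χ).toFun (component T α ψ z) :=
  ConcreteCategory.congr_hom (α.naturality χ ψ) z

theorem component_ext {α α' : (((J T).obj Y).functorHom ((J T).obj X)).obj C}
    (h : ∀ (C' : DObj) (ψ : C ⟶ C') (z : (prolong Y.obj C').carrier),
      component T α ψ z = component T α' ψ z) : α = α' := by
  apply Functor.functorHom_ext
  intro C' ψ
  ext z
  exact h C' ψ z

/-- The value in `X ⊗ W` of an element of `(J X ^ J Y) (C^∞(ℝⁿ) ⊗_∞ W)` at points of `ℝⁿ` and `Y`. -/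
def pointValue (α : (((J T).obj Y).functorHom ((J T).obj X)).obj C) (t : Fin C.n → ℝ)
    (y : Y.obj.carrier) : (weilProlongation X.obj C.W).carrier :=
  atPoint (C := ⟨0, C.W⟩) (component T α (baseMap C (fun _ : Fin 0 → ℝ => t) contDiff_const)
    (pureProlong C.W (constHom (Rn 0) y))) (0 : Fin 0 → ℝ)

/-- Naturality along the evaluation morphism of `D` at the point `x` of `ℝᴺ`. -/
theorem atPoint_component_baseMap (α : (((J T).obj Y).functorHom ((J T).obj X)).obj C) {N : ℕ}
    (a : (Fin N → ℝ) → Fin C.n → ℝ) (ha : ContDiff ℝ ∞ a) (g : Rn N ⟶ Y.obj) (x : Fin N → ℝ) :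
    atPoint (C := ⟨N, C.W⟩) (component T α (baseMap C a ha) (pureProlong C.W g)) x =
      pointValue T α (a x) (g.toFun x) := by
  have h := atPoint_map_baseMap T X ⟨N, C.W⟩ (fun _ : Fin 0 → ℝ => x) contDiff_const
    (component T α (baseMap C a ha) (pureProlong C.W g)) (0 : Fin 0 → ℝ)
  rw [← component_naturality, map_pureProlong, baseMap_comp] at h
  exact h.symm

/-- Any `ψ : C ⟶ C'` and class `[g]` come from a base map and a pure element over `D = C^∞(ℝⁿ' ×
ℝᵏ') ⊗_∞ W` through one morphism `χ : D ⟶ C'`: the Weil variables of `C'` are first treated as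
ordinary parameters. Naturality along `χ` leaves the case of `atPoint_component_baseMap`. -/
theorem ext_of_pointValue {α α' : (((J T).obj Y).functorHom ((J T).obj X)).obj C}
    (h : ∀ t y, pointValue T α t y = pointValue T α' t y) : α = α' := by
  refine component_ext T fun C' ψ z => ?_
  obtain ⟨g, rfl⟩ := prolongMk_surjective z
  obtain ⟨φ, hφ, hψ⟩ := exists_isSubst ψ
  have hspl : ContDiff ℝ ∞ fun w : Fin (C'.n + C'.W.k) → ℝ => (prFst C'.n C'.W.k w, prSnd C'.n C'.W.k w) :=
    (contDiff_prFst _ _).prodMk (contDiff_prSnd _ _)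
  let G : Rn (C'.n + C'.W.k) ⟶ Y.obj := ⟨fun w => value g (prFst _ _ w) (prSnd _ _ w), fun c hc =>
    value_mem_curves g ((contDiff_prFst _ _).comp (mem_Rn_curves.1 hc))
      ((contDiff_prSnd _ _).comp (mem_Rn_curves.1 hc))⟩
  have ha := (hφ.comp hspl).fst
  let D : DObj := ⟨C'.n + C'.W.k, C.W⟩
  have hdesc : ContDiff ℝ ∞ fun x : C'.Dom => ((Fin.append x.1 x.2, (φ x).2) : D.Dom) :=
    (contDiff_append contDiff_fst contDiff_snd).prodMk hφ.snd
  let χ : D ⟶ C' := substHom (C := D) _ hdesc fun F hF => by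
      -- That `ψ` preserves zero is taken from `hψ`. As `ψ` kills the ideal of `C`, substituting the
      -- second component of `φ` carries `I` into the ideal of `C'`.
      have h0 := hψ 0
      have h1 := hψ (pullback Prod.snd contDiff_snd F)
      have h2 : Ideal.Quotient.mk C.ideal (pullback Prod.snd contDiff_snd F) =
          Ideal.Quotient.mk C.ideal 0 := by
        rw [map_zero]
        exact Ideal.Quotient.eq_zero_iff_mem.2 (Ideal.mem_map_of_mem _ hF)
      rw [h2, h0, map_zero, map_zero] at h1
      exact Ideal.Quotient.eq_zero_iff_mem.1 h1.symm
  have e1 : baseMap C _ ha ≫ χ = ψ := by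
    refine ((IsSubst.comp (isSubst_substHom _ _ _) (isSubst_substHom _ _ _)).congr ?_).hom_ext hψ
    funext x
    change ((φ (prFst _ _ (Fin.append x.1 x.2), prSnd _ _ (Fin.append x.1 x.2))).1, (φ x).2) = φ x
    rw [prFst_append, prSnd_append]
  have e2 : (T.map Y χ).toFun (pureProlong C.W G) = prolongMk C' g := by
    refine (T.map_prolongMk Y (isSubst_substHom _ _ _) _).trans (congrArg _ (value_ext fun t s => ?_))
    change value g (prFst _ _ (Fin.append t s)) (prSnd _ _ (Fin.append t s)) = _
    rw [prFst_append, prSnd_append]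
  rw [← e1, ← e2, component_naturality, component_naturality]
  refine congrArg _ (atPoint_ext X.property fun x => ?_)
  exact (atPoint_component_baseMap T α _ ha G x).trans
    ((h _ _).trans (atPoint_component_baseMap T α' _ ha G x).symm)

/-- The point values of an element of `J X ^ J Y` form a smooth mapping `ℝⁿ × Y → X ⊗ W`. -/
def pointValueHom (α : (((J T).obj Y).functorHom ((J T).obj X)).obj C) :
    Hom (prod (Rn C.n) Y.obj) (weilProlongation X.obj C.W) where
  toFun p := pointValue T α p.1 p.2
  smooth c hc := by
    obtain ⟨h1, h2⟩ := mem_prod_curves.1 hc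
    have hpr : ContDiff ℝ ∞ fun x : Fin 1 → ℝ => x 0 := contDiff_apply ℝ ℝ 0
    let g : Rn 1 ⟶ Y.obj := ⟨fun x => (c (x 0)).2, fun d hd =>
      comp_mem_curves h2 (hpr.comp (mem_Rn_curves.1 hd))⟩
    let τ : ℝ → Fin C.n → ℝ := fun s => (c s).1
    have ha : ContDiff ℝ ∞ fun x : Fin 1 → ℝ => τ (x 0) := (mem_Rn_curves.1 h1).comp hpr
    -- A curve in `ℝⁿ × Y` gives a base map and a pure element over `ℝ¹`. The component of `α` there
    -- is an element of `X ⊗ (C^∞(ℝ¹) ⊗_∞ W)`, whose canonical image is a smooth curve in `X ⊗ W`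
    -- with the desired values.
    have h3 : (fun r : ℝ => atPoint (C := ⟨1, C.W⟩)
        (component T α (baseMap C _ ha) (pureProlong C.W g)) (fun _ : Fin 1 => r)) ∈
          (weilProlongation X.obj C.W).curves :=
      Hom.smooth (X := Rn 1) ((weilExpComparison X.obj (Rn 1) C.W).toFun
        (component T α (baseMap C _ ha) (pureProlong C.W g))) (fun r _ => r)
        (mem_Rn_curves.2 (contDiff_pi.2 fun _ => contDiff_id))
    simp_rw [atPoint_component_baseMap] at h3
    exact h3

end HomObj

/-! ### `J` preserves exponentials -/

/-- The transpose `J (X ^ Y) ⟶ J X ^ J Y` of evaluation. -/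
def evalTranspose (T : FunctorialInD) (X Y : FSWE) :
    (J T).obj (expFSWE X Y) ⟶ (ihom ((J T).obj Y)).obj ((J T).obj X) :=
  MonoidalClosed.curry (evalNat T X Y)

/-- The element of `(J X ^ J Y) (C)` given by an element of `(X ^ Y) ⊗ C`. -/
def transposeElement (T : FunctorialInD) (X Y : FSWE) (C : DObj)
    (w : (prolong (exp X.obj Y.obj) C).carrier) :
    (((J T).obj Y).functorHom ((J T).obj X)).obj C :=
  (evalTranspose T X Y).app C w

/-- Up to the exponential law, taking point values of the transpose is the canonical mapping for the
exponent `ℝⁿ × Y`. -/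
theorem pointValue_transposeElement (T : FunctorialInD) (X Y : FSWE) {C : DObj}
    (w : (weilProlongation (exp X.obj (prod (Rn C.n) Y.obj)) C.W).carrier) (t : Fin C.n → ℝ)
    (y : Y.obj.carrier) :
    pointValue T (transposeElement T X Y C
        ((weilMapIso (curryIso X.obj (Rn C.n) Y.obj) C.W).hom.toFun w)) t y =
      ev ((weilExpComparison X.obj (prod (Rn C.n) Y.obj) C.W).toFun w) (t, y) := by
  induction w using Quotient.inductionOn with | _ f => ?_
  have e := T.map_prolongMk (expFSWE X Y) (isSubst_substHom
    (C := C) (C' := ⟨0, C.W⟩) (fun x => (t, x.2)) (contDiff_const.prodMk contDiff_snd)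
      fun _ hF => Ideal.mem_map_of_mem _ hF)
    ((f : Rn C.W.k ⟶ _) ≫ (curryIso X.obj (Rn C.n) Y.obj).hom : Rn C.W.k ⟶ _)
  refine (congrArg (fun v => atPoint (evalProlong T X Y.obj ⟨0, C.W⟩
    (pureProlong C.W (constHom (Rn 0) y)) v) (0 : Fin 0 → ℝ)) e).trans ?_
  rfl

/-- Injectivity is that of the canonical mapping. For surjectivity, the smooth mapping of point
values of `α` is lifted through the canonical mapping, and `ext_of_pointValue` identifies the
transpose of the lift with `α`. -/
theorem transposeElement_bijective (T : FunctorialInD) (X Y : FSWE) (C : DObj) :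
    Function.Bijective (transposeElement T X Y C) := by
  have hc : Function.Surjective (weilMapIso (curryIso X.obj (Rn C.n) Y.obj) C.W).hom.toFun :=
    fun z => ⟨_, congrFun (congrArg Hom.toFun
      (weilMapIso (curryIso X.obj (Rn C.n) Y.obj) C.W).inv_hom_id) z⟩
  constructor
  · intro w w' h
    obtain ⟨v, rfl⟩ := hc w
    obtain ⟨v', rfl⟩ := hc w'
    refine congrArg _ (weilExpComparison_injective X.property _ _ (exp_ext fun p => ?_))
    exact (pointValue_transposeElement T X Y v p.1 p.2).symm.trans
      ((congrArg (fun α => pointValue T α p.1 p.2) h).trans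
        (pointValue_transposeElement T X Y v' p.1 p.2))
  · intro α
    obtain ⟨v, hv⟩ := weilExpComparison_surjective X.property (prod (Rn C.n) Y.obj) C.W
      (pointValueHom T α)
    refine ⟨(weilMapIso (curryIso X.obj (Rn C.n) Y.obj) C.W).hom.toFun v,
      ext_of_pointValue T fun t y => ?_⟩
    rw [pointValue_transposeElement, hv]
    rfl

instance isIso_evalTranspose (T : FunctorialInD) (X Y : FSWE) : IsIso (evalTranspose T X Y) := by
  have : ∀ C, IsIso ((evalTranspose T X Y).app C) := fun C =>
    (isIso_iff_bijective _).2 (transposeElement_bijective T X Y C)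
  exact NatIso.isIso_of_isIso_app _

/-- `J` preserves exponentials: `J (X ^ Y)` is isomorphic to `J X ^ J Y` in `Sets^D`, by the
isomorphism that corresponds to evaluation `([g], [f]) ↦ [ev (f, g)]`. -/
theorem propositiont4p4 (T : FunctorialInD) (X Y : FSWE) :
    ∃ (hXY : WeilExponentiable (exp X.obj Y.obj))
      (e : (J T).obj ⟨exp X.obj Y.obj, hXY⟩ ≅ (ihom ((J T).obj Y)).obj ((J T).obj X)),
      ∀ (C : DObj) (g : Hom (Rn C.W.k) (exp Y.obj (Rn C.n)))
        (f : Hom (Rn C.W.k) (exp (exp X.obj Y.obj) (Rn C.n)))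
        (k : Hom (Rn C.W.k) (exp X.obj (Rn C.n))),
        (∀ t s, value k t s = ev (value f t s) (value g t s)) →
        (MonoidalClosed.uncurry e.hom).app C (prolongMk C g, prolongMk C f) = prolongMk C k := by
  let e : (J T).obj (expFSWE X Y) ≅ (ihom ((J T).obj Y)).obj ((J T).obj X) :=
    asIso (evalTranspose T X Y)
  refine ⟨X.property.exp Y.obj, e, fun C g f k hk => ?_⟩
  have e1 : MonoidalClosed.uncurry e.hom = evalNat T X Y := MonoidalClosed.uncurry_curry _
  have e2 : k = evalRep g f := value_ext hk
  rw [e2]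
  exact congrArg (fun η : (J T).obj Y ⊗ (J T).obj (expFSWE X Y) ⟶ (J T).obj X =>
    ConcreteCategory.hom (η.app C) ((prolongMk C g, prolongMk C f) :
      (prolong Y.obj C).carrier × (prolong (exp X.obj Y.obj) C).carrier)) e1
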